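/- A BWR-game $\mathcal G=(G,p,r)$ consists of a finite digraph $G=(V,E)$ (loops and multiple arcs allowed) in which every vertex (position) has an outgoing arc, a partition $V=V_W\cup V_B\cup V_R$ into White, Black and random positions, a real local reward $r(e)$ for every arc $e$, and probabilities $p(e)>0$ for the arcs leaving random positions, which sum to $1$ at each random position. A strategy $s_W$ of White (respectively $s_B$ of Black) chooses one outgoing arc at each position of $V_W$ (respectively $V_B$). A situation $s=(s_W,s_B)$ defines a Markov chain on $V$ with transition matrix $P_s$. Put $P_s^*=\lim_{n\to\infty}\frac1{n+1}\sum_{i=0}^nP_s^i$ and $\mu_s(v)=\sum_{w\in V}P_s^*(v,w)\,\rho_s(w)$, where $\rho_s(w)$ is the expected local reward of one move from $w$. The situation $(s_W^*,s_B^*)$ is (uniformly) optimal if $$\mu_{(s_W,s_B^*)}(v)\le\mu_{(s_W^*,s_B^*)}(v)\le\mu_{(s_W^*,s_B)}(v)$$ for all strategies $s_W,s_B$ and all $v\in V$. The value of $\mathcal G$ from $v$ is $\mu_{\mathcal G}(v)=\max_{s_W}\min_{s_B}\mu_{(s_W,s_B)}(v)$, which is the common payoff $\mu_{s^*}(v)$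 of all optimal situations $s^*$. For $\theta\in\mathbb R$ let $S(\theta)=\{v\in V:\mu_{\mathcal G}(v)=\theta\}$. For $Y\subseteq V$ such that every $v\in Y\cap(V_W\cup V_B)$ has an arc to some position of $Y$, and for $x\in\mathbb R$, let $\mathcal G[Y](x)$ be the BWR-game obtained from $\mathcal G$ as follows. Delete all positions outside $Y$ and all arcs that do not have both ends in $Y$. Add a new deterministic position $w$ whose only outgoing arc is a loop with local reward $x$. For every $v\in V_R\cap Y$ whose deleted outgoing arcs have positive total probability, add an arc from $v$ to $w$ with local reward $0$ and with that total probability. **Lemma.** Let $\mathcal G$ be a BWR-game and let $\theta_1<\dots<\theta_\ell$ be the real numbers such that $S(\theta_i)\ne\emptyset$ for all $i$ and $\bigcup_{i=1}^\ell S(\theta_i)=V$. Then each game $\mathcal G[\theta_i]:=\mathcal G[S(\theta_i)](\theta_i)$ is well defined, that is, every $v\in S(\theta_i)\cap(V_W\cup V_B)$ has an arc to some position of $S(\theta_i)$. Moreover, if for every $i$ the situation $s^i=(s_W^i,s_B^i)$ is optimal in $\mathcal G[\theta_i]$, then the situation $s^*=(s_W^*,s_B^*)$ obtained by concatenating them,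 namely $s_W^*(v)=s_W^i(v)$ for $v\in V_W\cap S(\theta_i)$ and $s_B^*(v)=s_B^i(v)$ for $v\in V_B\cap S(\theta_i)$, is well defined and uniformly optimal in $\mathcal G$. -/

import Mathlib

/-- The three kinds of positions of a BWR-game. -/
inductive PositionKind
  | white
  | black
  | random

open scoped Classical in
/-- A BWR-game on a finite directed graph with vertex set `V` and arc set `E`; loops and parallel
arcs are allowed, and no position is terminal.  The values of `prob` matter only on arcs that leave
random positions. -/
structure BWRGame (V E : Type*) [Fintype V] [Fintype E] where
  kind : V → PositionKind
  src : E → V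
  tgt : E → V
  prob : E → ℝ
  reward : E → ℝ
  exists_arc : ∀ v, ∃ e, src e = v
  prob_pos : ∀ e, kind (src e) = PositionKind.random → 0 < prob e
  prob_sum : ∀ v, kind v = PositionKind.random → ∑ e with src e = v, prob e = 1

namespace BWRGame

open scoped Classical in
/-- The limiting matrix `P* = lim_n (I + P + ⋯ + P ^ n) / (n + 1)` of a Markov chain. -/
noncomputable def limitMatrix {V : Type*} [Fintype V] (P : Matrix V V ℝ) : Matrix V V ℝ :=
  fun v w => Filter.limUnder Filter.atTop
    (fun n : ℕ => (∑ i ∈ Finset.range (n + 1), (P ^ i) v w) / ((n : ℝ) + 1))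

open scoped Classical in
/-- The limit in the definition of `limitMatrix` exists for every stochastic matrix. -/
theorem tendsto_limitMatrix {V : Type*} [Fintype V] {P : Matrix V V ℝ}
    (h0 : ∀ v w, 0 ≤ P v w) (h1 : ∀ v, ∑ w, P v w = 1) (v w : V) :
    Filter.Tendsto (fun n : ℕ => (∑ i ∈ Finset.range (n + 1), (P ^ i) v w) / ((n : ℝ) + 1))
      Filter.atTop (nhds (limitMatrix P v w)) := by
  have hP : P ∈ Matrix.rowStochastic ℝ V := Matrix.mem_rowStochastic_iff_sum.2 ⟨h0, h1⟩
  let A : ℕ → Matrix V V ℝ := fun n => ((n : ℝ) + 1)⁻¹ • ∑ i ∈ Finset.range (n + 1), P ^ i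
  have hpos : ∀ n : ℕ, (0 : ℝ) < (n : ℝ) + 1 := fun n => by positivity
  have hA : ∀ n v w, A n v w
      = (∑ i ∈ Finset.range (n + 1), (P ^ i) v w) / ((n : ℝ) + 1) := fun n v w => by
    simp [A, Matrix.sum_apply, div_eq_inv_mul]
  have hle : ∀ (i : ℕ) v w, 0 ≤ (P ^ i) v w ∧ (P ^ i) v w ≤ 1 := fun i v w =>
    ⟨Matrix.nonneg_of_mem_rowStochastic (pow_mem hP i),
      Matrix.le_one_of_mem_rowStochastic (pow_mem hP i)⟩
  have hA01 : ∀ n v w, A n v w ∈ Set.Icc (0 : ℝ) 1 := fun n v w => by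
    rw [hA]
    refine ⟨div_nonneg (Finset.sum_nonneg fun i _ => (hle i v w).1) (hpos n).le, ?_⟩
    rw [div_le_one (hpos n)]
    exact (Finset.sum_le_sum fun i _ => (hle i v w).2).trans (by simp)
  have hcomm : ∀ n, P * A n = A n * P := fun n => by
    simp only [A, Matrix.mul_smul, Matrix.smul_mul, Finset.mul_sum, Finset.sum_mul]
    simp only [← pow_succ, ← pow_succ']
  have hdiff : ∀ n, A n * P - A n = ((n : ℝ) + 1)⁻¹ • (P ^ (n + 1) - 1) := fun n => by
    simp only [A, Matrix.smul_mul, ← smul_sub, Finset.sum_mul, ← pow_succ]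
    rw [← Finset.sum_sub_distrib, Finset.sum_range_sub (fun i => P ^ i), pow_zero]
  have hdiff0 : Filter.Tendsto (fun n => A n * P - A n) Filter.atTop (nhds 0) := by
    simp only [hdiff]
    refine tendsto_pi_nhds.2 fun v => tendsto_pi_nhds.2 fun w => ?_
    refine squeeze_zero_norm (a := fun n : ℕ => 1 / ((n : ℝ) + 1)) (fun n => ?_)
      tendsto_one_div_add_atTop_nhds_zero_nat
    have h2 := hle (n + 1) v w
    have h3 := hle 0 v w
    rw [pow_zero] at h3
    rw [Matrix.smul_apply, Matrix.sub_apply, smul_eq_mul, norm_mul, Real.norm_eq_abs,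
      Real.norm_eq_abs, abs_of_pos (inv_pos.2 (hpos n)), one_div]
    exact mul_le_of_le_one_right (inv_pos.2 (hpos n)).le
      (abs_le.2 ⟨by linarith [h2.1, h3.2], by linarith [h2.2, h3.1]⟩)
  have hK : IsCompact (Set.univ.pi fun _ : V => Set.univ.pi fun _ : V => Set.Icc (0 : ℝ) 1) :=
    isCompact_univ_pi fun _ => isCompact_univ_pi fun _ => isCompact_Icc
  have hAK : ∀ n, A n ∈ (Set.univ.pi fun _ : V => Set.univ.pi fun _ : V => Set.Icc (0 : ℝ) 1) :=
    fun n v _ w _ => hA01 n v w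
  have key : ∀ (Q : Matrix V V ℝ) (φ : ℕ → ℕ), StrictMono φ →
      Filter.Tendsto (fun n => A (φ n)) Filter.atTop (nhds Q) → P * Q = Q ∧ Q * P = Q := by
    intro Q φ hφ hQ
    have h4 : Filter.Tendsto (fun n => A (φ n) * P - A (φ n)) Filter.atTop (nhds 0) :=
      hdiff0.comp hφ.tendsto_atTop
    have h5 : Filter.Tendsto (fun n => A (φ n) * P - A (φ n)) Filter.atTop (nhds (Q * P - Q)) :=
      (((continuous_id.matrix_mul continuous_const).tendsto Q).comp hQ).sub hQ
    have h6 : Filter.Tendsto (fun n => A (φ n) * P - A (φ n)) Filter.atTop (nhds (P * Q - Q)) := by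
      simp only [← hcomm]
      exact (((continuous_const.matrix_mul continuous_id).tendsto Q).comp hQ).sub hQ
    exact ⟨sub_eq_zero.1 (tendsto_nhds_unique h6 h4), sub_eq_zero.1 (tendsto_nhds_unique h5 h4)⟩
  have hfixR : ∀ Q : Matrix V V ℝ, P * Q = Q → ∀ n, A n * Q = Q := by
    intro Q hQ n
    have : ∀ i : ℕ, P ^ i * Q = Q := fun i => by
      induction i with
      | zero => simp
      | succ i ih => rw [pow_succ, Matrix.mul_assoc, hQ, ih]
    simp only [A, Matrix.smul_mul, Finset.sum_mul, this, Finset.sum_const, Finset.card_range]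
    rw [← Nat.cast_smul_eq_nsmul ℝ, smul_smul]
    push_cast
    rw [inv_mul_cancel₀ (hpos n).ne', one_smul]
  have hfixL : ∀ Q : Matrix V V ℝ, Q * P = Q → ∀ n, Q * A n = Q := by
    intro Q hQ n
    have : ∀ i : ℕ, Q * P ^ i = Q := fun i => by
      induction i with
      | zero => simp
      | succ i ih => rw [pow_succ', ← Matrix.mul_assoc, hQ, ih]
    simp only [A, Matrix.mul_smul, Finset.mul_sum, this, Finset.sum_const, Finset.card_range]
    rw [← Nat.cast_smul_eq_nsmul ℝ, smul_smul]
    push_cast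
    rw [inv_mul_cancel₀ (hpos n).ne', one_smul]
  have hsub : ∀ ns : ℕ → ℕ, ∃ (Q : Matrix V V ℝ) (φ : ℕ → ℕ), StrictMono φ ∧
      Filter.Tendsto (fun n => A (ns (φ n))) Filter.atTop (nhds Q) := fun ns => by
    obtain ⟨Q, -, φ, hφ, hQ⟩ := hK.tendsto_subseq fun n => hAK (ns n)
    exact ⟨Q, φ, hφ, hQ⟩
  obtain ⟨Q, φ, hφ, hQ⟩ := hsub id
  simp only [id] at hQ
  have hQ' := key Q φ hφ hQ
  have hlim : Filter.Tendsto A Filter.atTop (nhds Q) := by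
    refine Filter.tendsto_of_subseq_tendsto fun ns hns => ?_
    obtain ⟨ψ, hψ, hψ'⟩ := Filter.strictMono_subseq_of_tendsto_atTop hns
    obtain ⟨R, χ, hχ, hR⟩ := hsub fun n => ns (ψ n)
    have hR' := key R (fun n => ns (ψ (χ n))) (hψ'.comp hχ) hR
    have h7 : Q * R = R := by
      refine tendsto_nhds_unique (f := fun n => A (φ n) * R)
        (((continuous_id.matrix_mul continuous_const).tendsto Q).comp hQ) ?_
      simp only [hfixR R hR'.1]
      exact tendsto_const_nhds
    have h8 : Q * R = Q := by
      refine tendsto_nhds_unique (f := fun n => Q * A (ns (ψ (χ n))))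
        (((continuous_const.matrix_mul continuous_id).tendsto R).comp hR) ?_
      simp only [hfixL Q hQ'.2]
      exact tendsto_const_nhds
    exact ⟨fun n => ψ (χ n), by rw [← h8, h7]; exact hR⟩
  refine tendsto_nhds_limUnder ⟨Q v w, ?_⟩
  simp only [← hA]
  exact tendsto_pi_nhds.1 (tendsto_pi_nhds.1 hlim v) w

variable {V E : Type*} [Fintype V] [Fintype E]

/-- A (pure stationary) strategy of the player who controls the positions of kind `c`: the choice of
an outgoing arc at each of these positions. -/
abbrev Strategy (G : BWRGame V E) (c : PositionKind) : Type _ :=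
  ∀ v : {v : V // G.kind v = c}, {e : E // G.src e = v.1}

abbrev WhiteStrategy (G : BWRGame V E) : Type _ := G.Strategy PositionKind.white

abbrev BlackStrategy (G : BWRGame V E) : Type _ := G.Strategy PositionKind.black

open scoped Classical in
/-- The probability that the play, being at the tail of `e`, moves along `e`, in the situation
`(sW, sB)`. -/
noncomputable def arcProb (G : BWRGame V E) (sW : G.WhiteStrategy) (sB : G.BlackStrategy)
    (e : E) : ℝ :=
  match h : G.kind (G.src e) with
  | PositionKind.white => if (sW ⟨G.src e, h⟩).1 = e then 1 else 0
  | PositionKind.black => if (sB ⟨G.src e, h⟩).1 = e then 1 else 0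
  | PositionKind.random => G.prob e

open scoped Classical in
/-- The transition matrix of the Markov chain of the situation `(sW, sB)`. -/
noncomputable def transition (G : BWRGame V E) (sW : G.WhiteStrategy) (sB : G.BlackStrategy) :
    Matrix V V ℝ :=
  fun v u => ∑ e with G.src e = v ∧ G.tgt e = u, G.arcProb sW sB e

theorem transition_nonneg (G : BWRGame V E) (sW : G.WhiteStrategy) (sB : G.BlackStrategy)
    (v u : V) : 0 ≤ G.transition sW sB v u := by
  refine Finset.sum_nonneg fun e _ => ?_
  unfold arcProb
  split
  · split_ifs <;> norm_num
  · split_ifs <;> norm_num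
  · next h => exact (G.prob_pos e h).le

theorem sum_transition (G : BWRGame V E) (sW : G.WhiteStrategy) (sB : G.BlackStrategy)
    (v : V) : ∑ u, G.transition sW sB v u = 1 := by
  classical
  have h1 : ∑ u, G.transition sW sB v u = ∑ e with G.src e = v, G.arcProb sW sB e := by
    simp only [transition, ← Finset.filter_filter]
    convert Finset.sum_fiberwise _ G.tgt _
  have h2 : ∀ a : E, G.src a = v →
      (∀ e, G.src e = v → G.arcProb sW sB e = if a = e then 1 else 0) →
      ∑ e with G.src e = v, G.arcProb sW sB e = 1 := fun a ha h => by
    rw [Finset.sum_congr rfl fun e he => h e (Finset.mem_filter.1 he).2]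
    simp [ha]
  rw [h1]
  cases hk : G.kind v with
  | white =>
    refine h2 _ (sW ⟨v, hk⟩).2 fun e he => ?_
    subst he
    unfold arcProb
    split
    · congr
    · next h => exact absurd (hk.symm.trans h) (by simp)
    · next h => exact absurd (hk.symm.trans h) (by simp)
  | black =>
    refine h2 _ (sB ⟨v, hk⟩).2 fun e he => ?_
    subst he
    unfold arcProb
    split
    · next h => exact absurd (hk.symm.trans h) (by simp)
    · congr
    · next h => exact absurd (hk.symm.trans h) (by simp)
  | random =>
    rw [← G.prob_sum v hk]
    refine Finset.sum_congr (by congr!) fun e he => ?_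
    have he' : G.src e = v := (Finset.mem_filter.1 he).2
    subst he'
    unfold arcProb
    split
    · next h => exact absurd (hk.symm.trans h) (by simp)
    · next h => exact absurd (hk.symm.trans h) (by simp)
    · rfl

open scoped Classical in
/-- The expected local reward of one move from `w` in the situation `(sW, sB)`. -/
noncomputable def localReward (G : BWRGame V E) (sW : G.WhiteStrategy) (sB : G.BlackStrategy)
    (w : V) : ℝ :=
  ∑ e with G.src e = w, G.arcProb sW sB e * G.reward e

/-- The limiting mean effective payoff of the situation `(sW, sB)` from the initial position `v`. -/
noncomputable def meanPayoff (G : BWRGame V E) (sW : G.WhiteStrategy) (sB : G.BlackStrategy)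
    (v : V) : ℝ :=
  ∑ w, limitMatrix (G.transition sW sB) v w * G.localReward sW sB w

/-- `(sW, sB)` is a saddle point from every initial position simultaneously (White maximizes,
Black minimizes). -/
def IsUniformlyOptimal (G : BWRGame V E) (sW : G.WhiteStrategy) (sB : G.BlackStrategy) : Prop :=
  ∀ (tW : G.WhiteStrategy) (tB : G.BlackStrategy) (v : V),
    G.meanPayoff tW sB v ≤ G.meanPayoff sW sB v ∧ G.meanPayoff sW sB v ≤ G.meanPayoff sW tB v

/-- The value of the game from the initial position `v`.  By `value_eq_meanPayoff` below it is the
payoff of every uniformly optimal situation. -/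
noncomputable def value (G : BWRGame V E) (v : V) : ℝ :=
  ⨆ sW : G.WhiteStrategy, ⨅ sB : G.BlackStrategy, G.meanPayoff sW sB v

theorem value_eq_meanPayoff (G : BWRGame V E) {sW : G.WhiteStrategy} {sB : G.BlackStrategy}
    (h : G.IsUniformlyOptimal sW sB) (v : V) : G.value v = G.meanPayoff sW sB v := by
  have : Nonempty G.WhiteStrategy := ⟨sW⟩
  have : Nonempty G.BlackStrategy := ⟨sB⟩
  apply le_antisymm
  · exact ciSup_le fun tW => (ciInf_le (Set.finite_range _).bddBelow sB).trans (h tW sB v).1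
  · exact (le_ciInf fun tB => (h sW tB v).2).trans
      (le_ciSup (f := fun tW => ⨅ tB, G.meanPayoff tW tB v) (Set.finite_range _).bddAbove sW)

open scoped Classical in
/-- `S(θ)`, the set of positions of value `θ`. -/
noncomputable def ergodicClass (G : BWRGame V E) (θ : ℝ) : Finset V :=
  Finset.univ.filter fun v => G.value v = θ

/-- No White or Black position of `Y` loses all its outgoing arcs when the game is restricted
to `Y`. -/
def Restrictable (G : BWRGame V E) (Y : Finset V) : Prop :=
  ∀ v ∈ Y, G.kind v ≠ PositionKind.random → ∃ e, G.src e = v ∧ G.tgt e ∈ Y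

open scoped Classical in
/-- The probability `p(v, w(Y))` of leaving `Y` in one move from a random position `v`. -/
noncomputable def exitProb (G : BWRGame V E) (Y : Finset V) (v : V) : ℝ :=
  1 - ∑ e with G.src e = v ∧ G.tgt e ∈ Y, G.prob e

/-- The arcs of `G[Y](x)`: the arcs of `G` inside `Y`; an arc to `w(Y)` from each random position
of `Y` that leaves `Y` with positive probability; the loop at `w(Y)`. -/
abbrev ParamArc (G : BWRGame V E) (Y : Finset V) : Type _ :=
  {e : E // G.src e ∈ Y ∧ G.tgt e ∈ Y} ⊕
    ({v : Y // G.kind v.1 = PositionKind.random ∧ 0 < G.exitProb Y v.1} ⊕ Unit)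

open scoped Classical in
noncomputable instance instFintypeParamArc (G : BWRGame V E) (Y : Finset V) :
    Fintype (G.ParamArc Y) :=
  inferInstanceAs (Fintype ({e : E // G.src e ∈ Y ∧ G.tgt e ∈ Y} ⊕
    ({v : Y // G.kind v.1 = PositionKind.random ∧ 0 < G.exitProb Y v.1} ⊕ Unit)))

/-- The parametrized game `G[Y](x)`.  Its positions are those of `Y` and the new position
`none = w(Y)`, which is counted as White; the loop is its only outgoing arc. -/
noncomputable def param (G : BWRGame V E) (Y : Finset V) (x : ℝ) (hY : G.Restrictable Y) :
    BWRGame (Option Y) (G.ParamArc Y) where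
  kind
    | some v => G.kind v.1
    | none => PositionKind.white
  src
    | Sum.inl e => some ⟨G.src e.1, e.2.1⟩
    | Sum.inr (Sum.inl v) => some v.1
    | Sum.inr (Sum.inr _) => none
  tgt
    | Sum.inl e => some ⟨G.tgt e.1, e.2.2⟩
    | Sum.inr _ => none
  prob
    | Sum.inl e => G.prob e.1
    | Sum.inr (Sum.inl v) => G.exitProb Y v.1.1
    | Sum.inr (Sum.inr _) => 1
  reward
    | Sum.inl e => G.reward e.1
    | Sum.inr (Sum.inl _) => 0
    | Sum.inr (Sum.inr _) => x
  exists_arc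
    | none => ⟨Sum.inr (Sum.inr ()), rfl⟩
    | some v => by
      classical
      by_cases hk : G.kind v.1 = PositionKind.random
      · by_cases h : ∃ e, G.src e = v.1 ∧ G.tgt e ∈ Y
        · obtain ⟨e, he, ht⟩ := h
          exact ⟨Sum.inl ⟨e, he ▸ v.2, ht⟩, congrArg some (Subtype.ext he)⟩
        · refine ⟨Sum.inr (Sum.inl ⟨v, hk, ?_⟩), rfl⟩
          unfold exitProb
          rw [Finset.filter_false_of_mem fun e _ he => h ⟨e, he⟩]
          simp
      · obtain ⟨e, he, ht⟩ := hY v.1 v.2 hk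
        exact ⟨Sum.inl ⟨e, he ▸ v.2, ht⟩, congrArg some (Subtype.ext he)⟩
  prob_pos
    | Sum.inl e => G.prob_pos e.1
    | Sum.inr (Sum.inl v) => fun _ => v.2.2
    | Sum.inr (Sum.inr _) => fun _ => one_pos
  prob_sum
    | none => nofun
    | some v => fun hk => by
      classical
      have h1 : (∑ e : {e : E // G.src e ∈ Y ∧ G.tgt e ∈ Y},
          if (some (⟨G.src e.1, e.2.1⟩ : Y)) = some v then G.prob e.1 else 0)
          = ∑ e with G.src e = v.1 ∧ G.tgt e ∈ Y, G.prob e := by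
        simp only [Option.some_inj, Subtype.ext_iff]
        rw [← Finset.sum_subtype (Finset.univ.filter fun e => G.src e ∈ Y ∧ G.tgt e ∈ Y)
          (fun e => by simp) (fun e => if G.src e = v.1 then G.prob e else 0),
          ← Finset.sum_filter, Finset.filter_filter]
        refine Finset.sum_congr (Finset.filter_congr fun e _ => ?_) fun _ _ => rfl
        exact ⟨fun h => ⟨h.2, h.1.2⟩, fun h => ⟨⟨h.1 ▸ v.2, h.2⟩, h.1⟩⟩
      have h2 : (∑ u : {u : Y // G.kind u.1 = PositionKind.random ∧ 0 < G.exitProb Y u.1},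
          if some u.1 = some v then G.exitProb Y u.1.1 else 0) = G.exitProb Y v.1 := by
        by_cases h : 0 < G.exitProb Y v.1
        · rw [Finset.sum_eq_single ⟨v, hk, h⟩]
          · simp
          · intro u _ hu
            exact if_neg fun h' => hu (Subtype.ext (Option.some_inj.1 h'))
          · simp
        · have h0 : 0 ≤ G.exitProb Y v.1 := by
            unfold exitProb
            rw [sub_nonneg, ← G.prob_sum v.1 hk]
            refine Finset.sum_le_sum_of_subset_of_nonneg
              (Finset.monotone_filter_right _ fun e _ he => he.1) fun e he _ => ?_
            exact (G.prob_pos e ((Finset.mem_filter.1 he).2.symm ▸ hk)).le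
          rw [le_antisymm (not_lt.1 h) h0]
          refine Finset.sum_eq_zero fun u _ => if_neg fun h' => h ?_
          rw [← Option.some_inj.1 h']
          exact u.2.2
      rw [Finset.sum_filter, Fintype.sum_sum_type, Fintype.sum_sum_type]
      have h3 : G.exitProb Y v.1 + ∑ e with G.src e = v.1 ∧ G.tgt e ∈ Y, G.prob e = 1 := by
        rw [exitProb]
        convert sub_add_cancel _ _
      rw [← h3, add_comm]
      congr 1
      · rw [← h2]
        convert add_zero _
        · simp
      · rw [← h1]
        congr!

/-- `(tW, tB)` is the concatenation of the situations `(sW i, sB i)` of the parametrized games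
`G[Y i](x i)`: at each White or Black position of `Y i` it chooses the same arc as
`(sW i, sB i)`. -/
def IsConcatenation (G : BWRGame V E) {ι : Type*} (Y : ι → Finset V) (x : ι → ℝ)
    (hY : ∀ i, G.Restrictable (Y i))
    (sW : ∀ i, (G.param (Y i) (x i) (hY i)).WhiteStrategy)
    (sB : ∀ i, (G.param (Y i) (x i) (hY i)).BlackStrategy)
    (tW : G.WhiteStrategy) (tB : G.BlackStrategy) : Prop :=
  (∀ (i : ι) (v : V) (hv : v ∈ Y i) (hk : G.kind v = PositionKind.white),
    ∃ h, (sW i ⟨some ⟨v, hv⟩, hk⟩).1 = Sum.inl ⟨(tW ⟨v, hk⟩).1, h⟩) ∧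
  (∀ (i : ι) (v : V) (hv : v ∈ Y i) (hk : G.kind v = PositionKind.black),
    ∃ h, (sB i ⟨some ⟨v, hv⟩, hk⟩).1 = Sum.inl ⟨(tB ⟨v, hk⟩).1, h⟩)

end BWRGame

/-! Everything rests on how the value behaves along arcs. An optimal situation exists
(`exists_isUniformlyOptimal`): discounted games have saddle points by contraction, there are
finitely many situations, so one of them is optimal for discount factors tending to 1, and
discounted payoffs tend to mean payoffs. Testing it against changes at one position
(`mulVec_le_of_deviation`) shows that no White arc raises the value and no Black arc lowers it. The
value is averaged at random positions, and arcs chosen by an optimal situation preserve it. Hence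
each class of equal value can be restricted to.

The rest uses recurrent states. A limiting average is determined by its values at recurrent states,
and a subharmonic function is constant along the moves from such states (`Recurrent.eq_of_step`). In
`G[θ]` the added position pays `θ`, and recurrent play elsewhere never exits, so it is also a play
of `G`. Restrictions of optimal strategies of `G` therefore secure `θ` for both players
(`IsUniformlyOptimal.param_ergodicClass`).

Finally, let White use the concatenated strategy against an arbitrary Black strategy. The value is
subharmonic for the resulting chain, so recurrent play stays in one class, where it is a play of
`G[θ i]` against an optimal White strategy and pays at least `θ i`. Averaging gives at least the
value from every start (`value_le_meanPayoff`); Black's case is symmetric. -/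

open Matrix Filter Topology

namespace BWRGame

section

/-! ### Limiting averages and recurrent states of finite Markov chains. -/

section Chain

variable {V : Type*} [Fintype V] {P : Matrix V V ℝ}

theorem mulVec_mono (h0 : ∀ v w, 0 ≤ P v w) {x y : V → ℝ} (h : x ≤ y) : P *ᵥ x ≤ P *ᵥ y :=
  fun v => Finset.sum_le_sum fun w _ => mul_le_mul_of_nonneg_left (h w) (h0 v w)

theorem norm_mulVec_le (h0 : ∀ v w, 0 ≤ P v w) (h1 : ∀ v, ∑ w, P v w = 1) (x : V → ℝ) :
    ‖P *ᵥ x‖ ≤ ‖x‖ := by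
  refine (pi_norm_le_iff_of_nonneg (norm_nonneg _)).2 fun v => ?_
  calc ‖(P *ᵥ x) v‖ ≤ ∑ w, ‖P v w * x w‖ := norm_sum_le _ _
    _ ≤ ∑ w, P v w * ‖x‖ := Finset.sum_le_sum fun w _ => by
      rw [norm_mul, Real.norm_of_nonneg (h0 v w)]
      exact mul_le_mul_of_nonneg_left (norm_le_pi_norm x w) (h0 v w)
    _ = ‖x‖ := by rw [← Finset.sum_mul, h1, one_mul]

open scoped Classical in
theorem tendsto_limitMatrix_mulVec (h0 : ∀ v w, 0 ≤ P v w) (h1 : ∀ v, ∑ w, P v w = 1)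
    (x : V → ℝ) (v : V) :
    Tendsto (fun n : ℕ => (∑ i ∈ Finset.range (n + 1), ((P ^ i) *ᵥ x) v) / ((n : ℝ) + 1))
      atTop (𝓝 ((limitMatrix P *ᵥ x) v)) := by
  have h : Tendsto (fun n : ℕ => ∑ w,
      (∑ i ∈ Finset.range (n + 1), (P ^ i) v w) / ((n : ℝ) + 1) * x w)
      atTop (𝓝 (∑ w, limitMatrix P v w * x w)) :=
    tendsto_finsetSum _ fun w _ => (tendsto_limitMatrix h0 h1 v w).mul_const _
  refine h.congr fun n => ?_
  simp only [Matrix.mulVec, dotProduct]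
  rw [Finset.sum_comm, Finset.sum_div]
  refine Finset.sum_congr rfl fun w _ => ?_
  rw [div_mul_eq_mul_div, Finset.sum_mul]

open scoped Classical in
/-- If the iterates of two vectors agree at two states, so do the limiting averages. -/
theorem limitMatrix_mulVec_congr {V' : Type*} [Fintype V'] {P' : Matrix V' V' ℝ}
    (h0 : ∀ v w, 0 ≤ P v w) (h1 : ∀ v, ∑ w, P v w = 1)
    (h0' : ∀ v w, 0 ≤ P' v w) (h1' : ∀ v, ∑ w, P' v w = 1)
    {x : V → ℝ} {x' : V' → ℝ} {v : V} {v' : V'}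
    (h : ∀ i, ((P' ^ i) *ᵥ x') v' = ((P ^ i) *ᵥ x) v) :
    (limitMatrix P' *ᵥ x') v' = (limitMatrix P *ᵥ x) v := by
  refine tendsto_nhds_unique (tendsto_limitMatrix_mulVec h0' h1' x' v') ?_
  simp only [h]
  exact tendsto_limitMatrix_mulVec h0 h1 x v

/-- Two chains that are related by a bisimulation have equal limiting averages. -/
theorem limitMatrix_mulVec_eq_of_rel {V' : Type*} [Fintype V'] {P' : Matrix V' V' ℝ}
    (h0 : ∀ v w, 0 ≤ P v w) (h1 : ∀ v, ∑ w, P v w = 1)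
    (h0' : ∀ v w, 0 ≤ P' v w) (h1' : ∀ v, ∑ w, P' v w = 1) (R : V' → V → Prop)
    (hR : ∀ (x' : V' → ℝ) (x : V → ℝ), (∀ a' a, R a' a → x' a' = x a) →
      ∀ a' a, R a' a → (P' *ᵥ x') a' = (P *ᵥ x) a)
    {x' : V' → ℝ} {x : V → ℝ} (hx : ∀ a' a, R a' a → x' a' = x a) {v' : V'} {v : V}
    (hv : R v' v) : (limitMatrix P' *ᵥ x') v' = (limitMatrix P *ᵥ x) v := by
  classical
  refine limitMatrix_mulVec_congr h0 h1 h0' h1' fun i => ?_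
  have : ∀ a' a, R a' a → ((P' ^ i) *ᵥ x') a' = ((P ^ i) *ᵥ x) a := by
    induction i with
    | zero => simpa using hx
    | succ i ih =>
      simp only [pow_succ', ← Matrix.mulVec_mulVec]
      exact hR _ _ ih
  exact this _ _ hv

open scoped Classical in
theorem limitMatrix_mulVec_apply_of_pow (h0 : ∀ v w, 0 ≤ P v w) (h1 : ∀ v, ∑ w, P v w = 1)
    {x : V → ℝ} {v : V} {c : ℝ} (h : ∀ i : ℕ, ((P ^ i) *ᵥ x) v = c) :
    (limitMatrix P *ᵥ x) v = c := by
  refine tendsto_nhds_unique (tendsto_limitMatrix_mulVec h0 h1 x v) ?_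
  refine tendsto_const_nhds.congr fun n => ?_
  simp only [h, Finset.sum_const, Finset.card_range, nsmul_eq_mul]
  push_cast
  rw [mul_div_cancel_left₀ _ (by positivity)]

theorem limitMatrix_mulVec_of_absorbing (h0 : ∀ v w, 0 ≤ P v w) (h1 : ∀ v, ∑ w, P v w = 1)
    {v : V} (hv : ∀ x : V → ℝ, (P *ᵥ x) v = x v) (x : V → ℝ) :
    (limitMatrix P *ᵥ x) v = x v := by
  classical
  refine limitMatrix_mulVec_apply_of_pow h0 h1 fun i => ?_
  induction i with
  | zero => simp
  | succ i ih => rw [pow_succ', ← Matrix.mulVec_mulVec, hv, ih]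

theorem limitMatrix_nonneg (h0 : ∀ v w, 0 ≤ P v w) (h1 : ∀ v, ∑ w, P v w = 1) (v w : V) :
    0 ≤ limitMatrix P v w := by
  classical
  have hP : P ∈ Matrix.rowStochastic ℝ V := Matrix.mem_rowStochastic_iff_sum.2 ⟨h0, h1⟩
  refine ge_of_tendsto' (tendsto_limitMatrix h0 h1 v w) fun n => ?_
  refine div_nonneg (Finset.sum_nonneg fun i _ => ?_) (by positivity)
  convert Matrix.nonneg_of_mem_rowStochastic (pow_mem hP i)

theorem limitMatrix_mulVec_of_mulVec_eq (h0 : ∀ v w, 0 ≤ P v w) (h1 : ∀ v, ∑ w, P v w = 1)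
    {x : V → ℝ} (hx : P *ᵥ x = x) : limitMatrix P *ᵥ x = x := by
  classical
  have : ∀ i : ℕ, (P ^ i) *ᵥ x = x := fun i => by
    induction i with
    | zero => simp
    | succ i ih => rw [pow_succ, ← Matrix.mulVec_mulVec, hx, ih]
  ext v
  exact limitMatrix_mulVec_apply_of_pow h0 h1 fun i => by rw [this]

open scoped Classical in
/-- The averages of `x` and of `P x` differ by a telescoping term that vanishes in the limit. -/
theorem limitMatrix_mulVec_mulVec (h0 : ∀ v w, 0 ≤ P v w) (h1 : ∀ v, ∑ w, P v w = 1)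
    (x : V → ℝ) : limitMatrix P *ᵥ (P *ᵥ x) = limitMatrix P *ᵥ x := by
  have hP : P ∈ Matrix.rowStochastic ℝ V := Matrix.mem_rowStochastic_iff_sum.2 ⟨h0, h1⟩
  ext v
  rw [← sub_eq_zero]
  refine tendsto_nhds_unique ((tendsto_limitMatrix_mulVec h0 h1 (P *ᵥ x) v).sub
    (tendsto_limitMatrix_mulVec h0 h1 x v)) ?_
  have hb : ∀ i, |((P ^ i) *ᵥ x) v| ≤ ∑ w, |x w| := fun i => by
    refine (Finset.abs_sum_le_sum_abs _ _).trans (Finset.sum_le_sum fun w _ => ?_)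
    rw [abs_mul]
    refine mul_le_of_le_one_left (abs_nonneg _) ?_
    rw [abs_of_nonneg (Matrix.nonneg_of_mem_rowStochastic (pow_mem hP i))]
    exact Matrix.le_one_of_mem_rowStochastic (pow_mem hP i)
  have hlim : Tendsto (fun n : ℕ => (2 * ∑ w, |x w|) * (1 / ((n : ℝ) + 1))) atTop (𝓝 0) := by
    simpa using tendsto_one_div_add_atTop_nhds_zero_nat.const_mul (2 * ∑ w, |x w|)
  refine squeeze_zero_norm (fun n => ?_) hlim
  have h2 : ∀ i : ℕ, (P ^ i) *ᵥ (P *ᵥ x) = (P ^ (i + 1)) *ᵥ x := fun i => by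
    rw [Matrix.mulVec_mulVec, ← pow_succ]
  simp only [h2]
  rw [← sub_div, ← Finset.sum_sub_distrib, Finset.sum_range_sub (fun i => ((P ^ i) *ᵥ x) v),
    Real.norm_eq_abs, abs_div, abs_of_pos (by positivity : (0 : ℝ) < (n : ℝ) + 1), mul_one_div]
  gcongr
  have := hb (n + 1)
  have := hb 0
  rw [abs_le] at *
  constructor <;> linarith

/-- `P` commutes with its powers, so it maps the averages of `x` to the averages of `P x`, and these
have the same limit by `limitMatrix_mulVec_mulVec`. -/
theorem mulVec_limitMatrix_mulVec (h0 : ∀ v w, 0 ≤ P v w) (h1 : ∀ v, ∑ w, P v w = 1)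
    (x : V → ℝ) : P *ᵥ (limitMatrix P *ᵥ x) = limitMatrix P *ᵥ x := by
  classical
  rw [← limitMatrix_mulVec_mulVec h0 h1]
  ext v
  have h : Tendsto (fun n : ℕ => ∑ w, P v w *
      ((∑ i ∈ Finset.range (n + 1), ((P ^ i) *ᵥ x) w) / ((n : ℝ) + 1)))
      atTop (𝓝 (∑ w, P v w * (limitMatrix P *ᵥ x) w)) :=
    tendsto_finsetSum _ fun w _ => (tendsto_limitMatrix_mulVec h0 h1 x w).const_mul _
  rw [limitMatrix_mulVec_mulVec h0 h1]
  refine tendsto_nhds_unique h ?_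
  rw [← limitMatrix_mulVec_mulVec h0 h1]
  refine (tendsto_limitMatrix_mulVec h0 h1 (P *ᵥ x) v).congr fun n => ?_
  have h2 : ∀ i : ℕ, ((P ^ i) *ᵥ (P *ᵥ x)) v = ∑ w, P v w * ((P ^ i) *ᵥ x) w := fun i => by
    rw [Matrix.mulVec_mulVec, ← pow_succ, pow_succ', ← Matrix.mulVec_mulVec]
    rfl
  simp only [h2]
  rw [Finset.sum_comm, Finset.sum_div]
  refine Finset.sum_congr rfl fun w _ => ?_
  rw [← Finset.mul_sum, mul_div_assoc]

theorem limitMatrix_mulVec_idem (h0 : ∀ v w, 0 ≤ P v w) (h1 : ∀ v, ∑ w, P v w = 1)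
    (x : V → ℝ) : limitMatrix P *ᵥ (limitMatrix P *ᵥ x) = limitMatrix P *ᵥ x :=
  limitMatrix_mulVec_of_mulVec_eq h0 h1 (mulVec_limitMatrix_mulVec h0 h1 x)

/-- Iterating `hf` keeps `f` below every `P ^ i` applied to `f`, hence below the averages. -/
theorem le_limitMatrix_mulVec (h0 : ∀ v w, 0 ≤ P v w) (h1 : ∀ v, ∑ w, P v w = 1)
    {f : V → ℝ} (hf : f ≤ P *ᵥ f) : f ≤ limitMatrix P *ᵥ f := by
  classical
  intro v
  refine ge_of_tendsto' (tendsto_limitMatrix_mulVec h0 h1 f v) fun n => ?_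
  have h : ∀ i : ℕ, f ≤ (P ^ i) *ᵥ f := fun i => by
    induction i with
    | zero => simp
    | succ i ih =>
      rw [pow_succ', ← Matrix.mulVec_mulVec]
      exact hf.trans (mulVec_mono h0 ih)
  rw [le_div_iff₀ (by positivity)]
  calc f v * ((n : ℝ) + 1) = ∑ i ∈ Finset.range (n + 1), f v := by simp [mul_comm]
    _ ≤ _ := Finset.sum_le_sum fun i _ => h i v

/-- The states that are charged by the limiting matrix, which are the recurrent ones. -/
def Recurrent (P : Matrix V V ℝ) (w : V) : Prop := ∃ v, 0 < limitMatrix P v w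

/-- The rows of the limiting matrix are invariant under `P`, so the weight at `u` is at least the
weight at `w` times `P w u`. -/
theorem Recurrent.step (h0 : ∀ v w, 0 ≤ P v w) (h1 : ∀ v, ∑ w, P v w = 1) {w u : V}
    (hw : Recurrent P w) (hu : 0 < P w u) : Recurrent P u := by
  classical
  obtain ⟨v, hv⟩ := hw
  refine ⟨v, ?_⟩
  have h := congrFun (limitMatrix_mulVec_mulVec h0 h1 (Pi.single u 1)) v
  simp only [Matrix.mulVec_single_one] at h
  rw [show limitMatrix P v u = (limitMatrix P).col u v from rfl, ← h]
  refine (mul_pos hv hu).trans_le ?_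
  exact Finset.single_le_sum (f := fun j => limitMatrix P v j * P j u)
    (fun j _ => mul_nonneg (limitMatrix_nonneg h0 h1 v j) (h0 j u)) (Finset.mem_univ w)

/-- An invariant row integrates the nonnegative defect `P f - f` to zero, so the defect vanishes
wherever the row is positive. -/
theorem Recurrent.eq_mulVec (h0 : ∀ v w, 0 ≤ P v w) (h1 : ∀ v, ∑ w, P v w = 1) {w : V}
    (hw : Recurrent P w) {f : V → ℝ} (hf : f ≤ P *ᵥ f) : (P *ᵥ f) w = f w := by
  obtain ⟨v, hv⟩ := hw
  have h := congrFun (limitMatrix_mulVec_mulVec h0 h1 f) v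
  have h2 : ∑ j, limitMatrix P v j * ((P *ᵥ f) j - f j) = 0 := by
    simp only [mul_sub, Finset.sum_sub_distrib]
    exact sub_eq_zero.2 h
  have h3 := (Finset.sum_eq_zero_iff_of_nonneg fun j _ =>
    mul_nonneg (limitMatrix_nonneg h0 h1 v j) (sub_nonneg.2 (hf j))).1 h2 w (Finset.mem_univ w)
  exact sub_eq_zero.1 ((mul_eq_zero.1 h3).resolve_left hv.ne')

/-- A subharmonic function is constant along the moves from a recurrent state. -/
theorem Recurrent.eq_of_step (h0 : ∀ v w, 0 ≤ P v w) (h1 : ∀ v, ∑ w, P v w = 1) {w u : V}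
    (hw : Recurrent P w) {f : V → ℝ} (hf : f ≤ P *ᵥ f) (hu : 0 < P w u) : f u = f w := by
  -- The shift makes `f + c` nonnegative, where squaring is increasing and convex, so that the
  -- square is subharmonic too.
  obtain ⟨c, hc⟩ : ∃ c : ℝ, ∀ v, 0 ≤ f v + c :=
    ⟨∑ v, |f v|, fun v => by
      have h : |f v| ≤ ∑ v, |f v| :=
        Finset.single_le_sum (f := fun v => |f v|) (fun _ _ => abs_nonneg _) (Finset.mem_univ v)
      linarith [neg_abs_le (f v)]⟩
  -- Expanding the square around `f v` leaves a drift term and a variance term.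
  have hvar : ∀ v, (P *ᵥ fun j => (f j + c) ^ 2) v
      = (f v + c) ^ 2 + 2 * (f v + c) * ((P *ᵥ f) v - f v) + ∑ j, P v j * (f j - f v) ^ 2 :=
    fun v => by
      have h2 : (f v + c) ^ 2 + 2 * (f v + c) * ((P *ᵥ f) v - f v)
          = (c ^ 2 - f v ^ 2) * (∑ j, P v j) + 2 * (f v + c) * (P *ᵥ f) v := by
        rw [h1]; ring
      rw [h2]
      simp only [Matrix.mulVec, dotProduct, Finset.mul_sum, ← Finset.sum_add_distrib]
      refine Finset.sum_congr rfl fun j _ => ?_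
      ring
  have hnn : ∀ v j, 0 ≤ P v j * (f j - f v) ^ 2 := fun v j => mul_nonneg (h0 v j) (sq_nonneg _)
  have hg : (fun j => (f j + c) ^ 2) ≤ P *ᵥ fun j => (f j + c) ^ 2 := fun v => by
    rw [hvar v]
    have h2 : 0 ≤ 2 * (f v + c) * ((P *ᵥ f) v - f v) :=
      mul_nonneg (mul_nonneg two_pos.le (hc v)) (sub_nonneg.2 (hf v))
    have h3 : 0 ≤ ∑ j, P v j * (f j - f v) ^ 2 := Finset.sum_nonneg fun j _ => hnn v j
    linarith
  -- At a recurrent state both `f` and the square have no drift, so the variance of the next value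
  -- of `f` is zero.
  have h4 := hw.eq_mulVec h0 h1 hg
  rw [hvar w, hw.eq_mulVec h0 h1 hf] at h4
  have h5 : ∑ j, P w j * (f j - f w) ^ 2 = 0 := by linarith
  have h6 := (Finset.sum_eq_zero_iff_of_nonneg fun j _ => hnn w j).1 h5 u (Finset.mem_univ u)
  exact sub_eq_zero.1 (pow_eq_zero_iff two_ne_zero |>.1 ((mul_eq_zero.1 h6).resolve_left hu.ne'))

/-- A bound for limiting averages need only be checked at recurrent states. -/
theorem limitMatrix_mulVec_le_of_recurrent (h0 : ∀ v w, 0 ≤ P v w) (h1 : ∀ v, ∑ w, P v w = 1)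
    {f x : V → ℝ} (h : ∀ w, Recurrent P w → f w ≤ (limitMatrix P *ᵥ x) w) :
    limitMatrix P *ᵥ f ≤ limitMatrix P *ᵥ x := by
  -- By idempotence both sides become averages under rows of the limiting matrix, which charge only
  -- recurrent states.
  rw [← limitMatrix_mulVec_idem h0 h1 x]
  refine fun v => Finset.sum_le_sum fun w _ => ?_
  change limitMatrix P v w * f w ≤ limitMatrix P v w * (limitMatrix P *ᵥ x) w
  rcases (limitMatrix_nonneg h0 h1 v w).eq_or_lt with h2 | h2
  · rw [← h2, zero_mul, zero_mul]
  · exact mul_le_mul_of_nonneg_left (h w ⟨v, h2⟩) h2.le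

/-- The discounted payoffs converge to the mean payoff. -/
theorem tendsto_discounted (h0 : ∀ v w, 0 ≤ P v w) (h1 : ∀ v, ∑ w, P v w = 1) {ρ : V → ℝ}
    {β : ℕ → ℝ} (hβ : ∀ n, 0 ≤ β n ∧ β n < 1) (hβ1 : Tendsto β atTop (𝓝 1))
    {x : ℕ → V → ℝ} (hx : ∀ n, x n = (1 - β n) • ρ + β n • (P *ᵥ x n)) :
    Tendsto x atTop (𝓝 (limitMatrix P *ᵥ ρ)) := by
  have hb : ∀ n, x n ∈ Metric.closedBall (0 : V → ℝ) ‖ρ‖ := fun n => by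
    rw [mem_closedBall_zero_iff]
    have h2 : ‖x n‖ ≤ (1 - β n) * ‖ρ‖ + β n * ‖x n‖ := by
      conv_lhs => rw [hx n]
      refine (norm_add_le _ _).trans ?_
      rw [norm_smul, norm_smul, Real.norm_of_nonneg (hβ n).1,
        Real.norm_of_nonneg (sub_nonneg.2 (hβ n).2.le)]
      gcongr
      · exact (hβ n).1
      · exact norm_mulVec_le h0 h1 _
    have h3 : 0 < 1 - β n := sub_pos.2 (hβ n).2
    nlinarith
  -- Applying the limiting matrix to the discounted equation absorbs `P`, and the factor `1 - β n`
  -- cancels.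
  have hlim : ∀ n, limitMatrix P *ᵥ x n = limitMatrix P *ᵥ ρ := fun n => by
    have h2 : limitMatrix P *ᵥ x n
        = (1 - β n) • (limitMatrix P *ᵥ ρ) + β n • (limitMatrix P *ᵥ x n) := by
      conv_lhs => rw [hx n]
      rw [Matrix.mulVec_add, Matrix.mulVec_smul, Matrix.mulVec_smul,
        limitMatrix_mulVec_mulVec h0 h1]
    have h3 : (1 - β n) • (limitMatrix P *ᵥ x n) = (1 - β n) • (limitMatrix P *ᵥ ρ) := by
      rw [sub_smul, one_smul]
      exact sub_eq_of_eq_add h2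
    exact smul_right_injective _ (sub_pos.2 (hβ n).2).ne' h3
  -- By compactness only subsequential limits `y` need identification: letting the discount tend to
  -- 1 makes `y` harmonic, so it equals its own limiting average, which `hlim` computes.
  refine tendsto_of_subseq_tendsto fun ns hns => ?_
  obtain ⟨y, -, φ, hφ, hy⟩ := (isCompact_closedBall (0 : V → ℝ) ‖ρ‖).tendsto_subseq
    fun n => hb (ns n)
  have hns' : Tendsto (fun n => β (ns (φ n))) atTop (𝓝 1) :=
    hβ1.comp (hns.comp hφ.tendsto_atTop)
  have hcont : ∀ Q : Matrix V V ℝ, Tendsto (fun n => Q *ᵥ x (ns (φ n))) atTop (𝓝 (Q *ᵥ y)) :=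
    fun Q => ((continuous_const.matrix_mulVec continuous_id).tendsto y).comp hy
  have hfix : P *ᵥ y = y := by
    have h2 : Tendsto (fun n => x (ns (φ n))) atTop (𝓝 (P *ᵥ y)) := by
      have h3 := ((tendsto_const_nhds (x := (1 : ℝ))).sub hns').smul_const ρ |>.add
        (hns'.smul (hcont P))
      simp only [← hx, sub_self, zero_smul, zero_add, one_smul] at h3
      exact h3
    exact tendsto_nhds_unique h2 hy
  refine ⟨φ, ?_⟩
  have h4 : limitMatrix P *ᵥ ρ = y := by
    rw [← limitMatrix_mulVec_of_mulVec_eq h0 h1 hfix]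
    refine tendsto_nhds_unique ?_ (hcont (limitMatrix P))
    simp only [hlim]
    exact tendsto_const_nhds
  rw [h4]
  exact hy

/-- A vector that exceeds its discounted expectation is nonnegative. -/
theorem nonneg_of_discounted_le (h0 : ∀ v w, 0 ≤ P v w) (h1 : ∀ v, ∑ w, P v w = 1) {β : ℝ}
    (hβ0 : 0 ≤ β) (hβ : β < 1) {z : V → ℝ} (hz : β • (P *ᵥ z) ≤ z) : 0 ≤ z := by
  intro v
  -- At a minimizing state `u` the average is at least `z u`, so `β * z u ≤ z u` and `z u` is
  -- nonnegative.
  obtain ⟨u, -, hu⟩ := Finset.exists_min_image Finset.univ z ⟨v, Finset.mem_univ v⟩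
  refine le_trans ?_ (hu v (Finset.mem_univ v))
  have h2 : z u ≤ (P *ᵥ z) u :=
    calc z u = ∑ w, P u w * z u := by rw [← Finset.sum_mul, h1, one_mul]
      _ ≤ _ := Finset.sum_le_sum fun w _ =>
        mul_le_mul_of_nonneg_left (hu w (Finset.mem_univ w)) (h0 u w)
  have h3 : β * (P *ᵥ z) u ≤ z u := hz u
  rw [Pi.zero_apply]
  nlinarith [mul_le_mul_of_nonneg_left h2 hβ0]

theorem exists_eq_of_contracting {β : ℝ} (hβ0 : 0 ≤ β) (hβ : β < 1) {T : (V → ℝ) → V → ℝ}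
    (hT : ∀ x y v, |T x v - T y v| ≤ β * ‖x - y‖) : ∃ x, T x = x := by
  have h : ContractingWith ⟨β, hβ0⟩ T := by
    refine ⟨hβ, LipschitzWith.of_dist_le_mul fun x y => ?_⟩
    rw [dist_eq_norm, dist_eq_norm]
    exact (pi_norm_le_iff_of_nonneg (mul_nonneg hβ0 (norm_nonneg _))).2 fun v => hT x y v
  exact ⟨_, h.fixedPoint_isFixedPt⟩

theorem exists_discounted (h0 : ∀ v w, 0 ≤ P v w) (h1 : ∀ v, ∑ w, P v w = 1) {β : ℝ}
    (hβ0 : 0 ≤ β) (hβ : β < 1) (ρ : V → ℝ) : ∃ x, x = (1 - β) • ρ + β • (P *ᵥ x) := by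
  obtain ⟨x, hx⟩ := exists_eq_of_contracting (T := fun x => (1 - β) • ρ + β • (P *ᵥ x)) hβ0 hβ
    fun x y v => by
      simp only [Pi.add_apply, Pi.smul_apply, smul_eq_mul, add_sub_add_left_eq_sub]
      rw [← mul_sub, ← Pi.sub_apply (P *ᵥ x), ← Matrix.mulVec_sub, abs_mul, abs_of_nonneg hβ0]
      exact mul_le_mul_of_nonneg_left
        ((norm_le_pi_norm _ v).trans (norm_mulVec_le h0 h1 _)) hβ0
  exact ⟨x, hx.symm⟩

/-- If changing the chain and the reward at the state `v` does not increase the limiting average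
reward, then the new move at `v` does not increase the expected value of this average. -/
theorem mulVec_le_of_deviation {P' : Matrix V V ℝ} (h0 : ∀ v w, 0 ≤ P v w)
    (h1 : ∀ v, ∑ w, P v w = 1) (h0' : ∀ v w, 0 ≤ P' v w) (h1' : ∀ v, ∑ w, P' v w = 1)
    {ρ ρ' : V → ℝ} {v : V} (hP : ∀ u, u ≠ v → P' u = P u) (hρ : ∀ u, u ≠ v → ρ' u = ρ u)
    (hle : limitMatrix P' *ᵥ ρ' ≤ limitMatrix P *ᵥ ρ) :
    (P' *ᵥ (limitMatrix P *ᵥ ρ)) v ≤ (limitMatrix P *ᵥ ρ) v := by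
  -- If the new move were better on average, `f` would be subharmonic for `P'`, strictly at `v`.
  -- Then `v` is not recurrent for `P'`, and recurrent play never meets the change.
  by_contra! hlt
  have hf := mulVec_limitMatrix_mulVec h0 h1 ρ
  set f := limitMatrix P *ᵥ ρ
  have hsub : f ≤ P' *ᵥ f := fun u => by
    by_cases hu : u = v
    · rw [hu]
      exact hlt.le
    · refine le_of_eq ?_
      conv_lhs => rw [← hf]
      simp only [Matrix.mulVec, hP u hu]
  have hne : ∀ w, Recurrent P' w → w ≠ v := by
    rintro w hw rfl
    exact hlt.ne' (hw.eq_mulVec h0' h1' hsub)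
  have heq : ∀ w, Recurrent P' w → (limitMatrix P' *ᵥ ρ') w = f w := fun w hw => by
    refine limitMatrix_mulVec_eq_of_rel h0 h1 h0' h1' (fun a' a => a' = a ∧ Recurrent P' a) ?_ ?_
      ⟨rfl, hw⟩
    · rintro x' x hx a' a ⟨rfl, ha⟩
      refine Finset.sum_congr rfl fun u _ => ?_
      rw [← hP a' (hne a' ha)]
      rcases (h0' a' u).eq_or_lt with h2 | h2
      · simp [← h2]
      · rw [hx u u ⟨rfl, ha.step h0' h1' h2⟩]
    · rintro a' a ⟨rfl, ha⟩
      exact hρ a' (hne a' ha)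
  -- Bounding `P' f` instead of `f` retains the strict gain at `v`, which contradicts `hle`.
  have h2 : P' *ᵥ f ≤ limitMatrix P' *ᵥ ρ' := by
    calc P' *ᵥ f ≤ P' *ᵥ (limitMatrix P' *ᵥ f) :=
          mulVec_mono h0' (le_limitMatrix_mulVec h0' h1' hsub)
      _ = limitMatrix P' *ᵥ f := mulVec_limitMatrix_mulVec h0' h1' f
      _ ≤ _ := limitMatrix_mulVec_le_of_recurrent h0' h1' fun w hw => (heq w hw).ge
  exact absurd ((h2 v).trans (hle v)) hlt.not_ge

end Chain

end

/-! ### Discounted games, existence of optimal situations, and payoffs along arcs. -/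

section

theorem abs_ciSup_sub_ciSup_le {ι : Type*} [Finite ι] [Nonempty ι] {f g : ι → ℝ} {c : ℝ}
    (h : ∀ i, |f i - g i| ≤ c) : |(⨆ i, f i) - ⨆ i, g i| ≤ c := by
  rw [abs_sub_le_iff]
  constructor <;> rw [sub_le_iff_le_add] <;> refine ciSup_le fun i => ?_
  · have := le_ciSup (Set.finite_range g).bddAbove i
    linarith [(abs_sub_le_iff.1 (h i)).1]
  · have := le_ciSup (Set.finite_range f).bddAbove i
    linarith [(abs_sub_le_iff.1 (h i)).2]

theorem abs_ciInf_sub_ciInf_le {ι : Type*} [Finite ι] [Nonempty ι] {f g : ι → ℝ} {c : ℝ}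
    (h : ∀ i, |f i - g i| ≤ c) : |(⨅ i, f i) - ⨅ i, g i| ≤ c := by
  rw [abs_sub_le_iff]
  constructor <;> rw [sub_le_iff_le_add, ← sub_le_iff_le_add'] <;> refine le_ciInf fun i => ?_
  · have := ciInf_le (Set.finite_range f).bddBelow i
    linarith [(abs_sub_le_iff.1 (h i)).1]
  · have := ciInf_le (Set.finite_range g).bddBelow i
    linarith [(abs_sub_le_iff.1 (h i)).2]

variable {V E : Type*} [Fintype V] [Fintype E]

open scoped Classical in
/-- The expectation of `F` at the arc along which the play leaves `v`. -/
noncomputable def arcMean (G : BWRGame V E) (sW : G.WhiteStrategy) (sB : G.BlackStrategy)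
    (F : E → ℝ) (v : V) : ℝ :=
  ∑ e with G.src e = v, G.arcProb sW sB e * F e

section ArcMean

variable (G : BWRGame V E) (sW : G.WhiteStrategy) (sB : G.BlackStrategy)

theorem transition_mulVec (x : V → ℝ) (v : V) :
    (G.transition sW sB *ᵥ x) v = G.arcMean sW sB (fun e => x (G.tgt e)) v := by
  classical
  simp only [Matrix.mulVec, dotProduct, transition, arcMean, ← Finset.filter_filter]
  rw [← Finset.sum_fiberwise _ G.tgt]
  refine Finset.sum_congr rfl fun u _ => ?_
  rw [Finset.sum_mul]
  refine Finset.sum_congr (by congr!) fun e he => ?_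
  rw [(Finset.mem_filter.1 he).2]

theorem localReward_eq_arcMean (v : V) : G.localReward sW sB v = G.arcMean sW sB G.reward v := rfl

theorem meanPayoff_eq_mulVec :
    G.meanPayoff sW sB = limitMatrix (G.transition sW sB) *ᵥ G.localReward sW sB := rfl

theorem arcProb_white {e : E} (h : G.kind (G.src e) = PositionKind.white) [Decidable
    ((sW ⟨G.src e, h⟩).1 = e)] :
    G.arcProb sW sB e = if (sW ⟨G.src e, h⟩).1 = e then 1 else 0 := by
  unfold arcProb
  split
  · congr
  · next h' => exact absurd (h.symm.trans h') (by simp)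
  · next h' => exact absurd (h.symm.trans h') (by simp)

theorem arcProb_black {e : E} (h : G.kind (G.src e) = PositionKind.black) [Decidable
    ((sB ⟨G.src e, h⟩).1 = e)] :
    G.arcProb sW sB e = if (sB ⟨G.src e, h⟩).1 = e then 1 else 0 := by
  unfold arcProb
  split
  · next h' => exact absurd (h.symm.trans h') (by simp)
  · congr
  · next h' => exact absurd (h.symm.trans h') (by simp)

theorem arcProb_random {e : E} (h : G.kind (G.src e) = PositionKind.random) :
    G.arcProb sW sB e = G.prob e := by
  unfold arcProb
  split
  · next h' => exact absurd (h.symm.trans h') (by simp)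
  · next h' => exact absurd (h.symm.trans h') (by simp)
  · rfl

theorem arcProb_nonneg (e : E) : 0 ≤ G.arcProb sW sB e := by
  unfold arcProb
  split
  · split_ifs <;> norm_num
  · split_ifs <;> norm_num
  · next h => exact (G.prob_pos e h).le

theorem arcMean_white (F : E → ℝ) {v : V} (h : G.kind v = PositionKind.white) :
    G.arcMean sW sB F v = F (sW ⟨v, h⟩).1 := by
  classical
  rw [arcMean, Finset.sum_eq_single (sW ⟨v, h⟩).1]
  · have h2 := (sW ⟨v, h⟩).2
    rw [arcProb_white G sW sB (h2.symm ▸ h), if_pos, one_mul]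
    congr!
  · intro e he hne
    obtain rfl := (Finset.mem_filter.1 he).2
    rw [arcProb_white G sW sB h, if_neg hne.symm, zero_mul]
  · intro h2
    exact absurd (by simp [(sW ⟨v, h⟩).2]) h2

theorem arcMean_black (F : E → ℝ) {v : V} (h : G.kind v = PositionKind.black) :
    G.arcMean sW sB F v = F (sB ⟨v, h⟩).1 := by
  classical
  rw [arcMean, Finset.sum_eq_single (sB ⟨v, h⟩).1]
  · have h2 := (sB ⟨v, h⟩).2
    rw [arcProb_black G sW sB (h2.symm ▸ h), if_pos, one_mul]
    congr!
  · intro e he hne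
    obtain rfl := (Finset.mem_filter.1 he).2
    rw [arcProb_black G sW sB h, if_neg hne.symm, zero_mul]
  · intro h2
    exact absurd (by simp [(sB ⟨v, h⟩).2]) h2

theorem arcMean_random (F : E → ℝ) {v : V} (h : G.kind v = PositionKind.random)
    [DecidablePred fun e => G.src e = v] :
    G.arcMean sW sB F v = ∑ e with G.src e = v, G.prob e * F e := by
  refine Finset.sum_congr (by congr!) fun e he => ?_
  obtain rfl := (Finset.mem_filter.1 he).2
  rw [arcProb_random G sW sB h]

theorem transition_pos {e : E} (h : 0 < G.arcProb sW sB e) :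
    0 < G.transition sW sB (G.src e) (G.tgt e) := by
  classical
  exact h.trans_le (Finset.single_le_sum (f := fun e => G.arcProb sW sB e)
    (fun e _ => G.arcProb_nonneg sW sB e) (Finset.mem_filter.2 ⟨Finset.mem_univ e, rfl, rfl⟩))

theorem arcMean_discounted (β : ℝ) (x : V → ℝ) (v : V) :
    ((1 - β) • G.localReward sW sB + β • (G.transition sW sB *ᵥ x)) v
      = G.arcMean sW sB (fun e => (1 - β) * G.reward e + β * x (G.tgt e)) v := by
  simp only [Pi.add_apply, Pi.smul_apply, smul_eq_mul, transition_mulVec, localReward, arcMean,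
    Finset.mul_sum, ← Finset.sum_add_distrib]
  exact Finset.sum_congr rfl fun e _ => by ring

end ArcMean

theorem arcProb_white_self (G : BWRGame V E) (tW : G.WhiteStrategy) (tB : G.BlackStrategy)
    (v : {v : V // G.kind v = PositionKind.white}) : G.arcProb tW tB (tW v).1 = 1 := by
  classical
  have h := (tW v).2
  rw [arcProb_white G _ _ (h.symm ▸ v.2), if_pos]
  congr!

theorem arcProb_black_self (G : BWRGame V E) (tW : G.WhiteStrategy) (tB : G.BlackStrategy)
    (v : {v : V // G.kind v = PositionKind.black}) : G.arcProb tW tB (tB v).1 = 1 := by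
  classical
  have h := (tB v).2
  rw [arcProb_black G _ _ (h.symm ▸ v.2), if_pos]
  congr!

theorem limitMatrix_transition_const (G : BWRGame V E) (tW : G.WhiteStrategy)
    (tB : G.BlackStrategy) (c : ℝ) :
    limitMatrix (G.transition tW tB) *ᵥ (fun _ => c) = fun _ => c :=
  limitMatrix_mulVec_of_mulVec_eq (G.transition_nonneg tW tB) (G.sum_transition tW tB) <| by
    ext v
    change ∑ w, G.transition tW tB v w * c = c
    rw [← Finset.sum_mul, sum_transition, one_mul]

open scoped Classical in
/-- The one-step optimality operator of the discounted game. -/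
noncomputable def shapley (G : BWRGame V E) (β : ℝ) (x : V → ℝ) (v : V) : ℝ :=
  match G.kind v with
  | PositionKind.white =>
    ⨆ e : {e : E // G.src e = v}, (1 - β) * G.reward e.1 + β * x (G.tgt e.1)
  | PositionKind.black =>
    ⨅ e : {e : E // G.src e = v}, (1 - β) * G.reward e.1 + β * x (G.tgt e.1)
  | PositionKind.random =>
    ∑ e with G.src e = v, G.prob e * ((1 - β) * G.reward e + β * x (G.tgt e))

/-- Maxima, minima and averages are nonexpansive in the sup norm, and the continuation is scaled by
`β`; for `β < 1` the operator is thus a contraction. -/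
theorem abs_shapley_sub_le (G : BWRGame V E) {β : ℝ} (hβ : 0 ≤ β) (x y : V → ℝ) (v : V) :
    |G.shapley β x v - G.shapley β y v| ≤ β * ‖x - y‖ := by
  classical
  have : Nonempty {e : E // G.src e = v} := let ⟨e, he⟩ := G.exists_arc v; ⟨⟨e, he⟩⟩
  have h : ∀ e : E, |(1 - β) * G.reward e + β * x (G.tgt e)
      - ((1 - β) * G.reward e + β * y (G.tgt e))| ≤ β * ‖x - y‖ := fun e => by
    rw [add_sub_add_left_eq_sub, ← mul_sub, abs_mul, abs_of_nonneg hβ]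
    exact mul_le_mul_of_nonneg_left (norm_le_pi_norm (x - y) _) hβ
  unfold shapley
  cases hk : G.kind v with
  | white => exact abs_ciSup_sub_ciSup_le fun e => h e.1
  | black => exact abs_ciInf_sub_ciInf_le fun e => h e.1
  | random =>
    have h2 : β * ‖x - y‖ = ∑ e with G.src e = v, G.prob e * (β * ‖x - y‖) := by
      rw [← Finset.sum_mul, G.prob_sum v hk, one_mul]
    simp only
    rw [← Finset.sum_sub_distrib, h2]
    refine (Finset.abs_sum_le_sum_abs _ _).trans (Finset.sum_le_sum fun e he => ?_)
    obtain rfl := (Finset.mem_filter.1 he).2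
    rw [← mul_sub, abs_mul, abs_of_pos (G.prob_pos e hk)]
    exact mul_le_mul_of_nonneg_left (h e) (G.prob_pos e hk).le

/-- The discounted game has optimal stationary strategies. -/
theorem exists_discounted_saddle (G : BWRGame V E) {β : ℝ} (hβ0 : 0 ≤ β) (hβ : β < 1) :
    ∃ (s : G.WhiteStrategy × G.BlackStrategy) (x : V → ℝ),
      x = (1 - β) • G.localReward s.1 s.2 + β • (G.transition s.1 s.2 *ᵥ x) ∧
      (∀ tW, (1 - β) • G.localReward tW s.2 + β • (G.transition tW s.2 *ᵥ x) ≤ x) ∧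
      ∀ tB, x ≤ (1 - β) • G.localReward s.1 tB + β • (G.transition s.1 tB *ᵥ x) := by
  classical
  obtain ⟨x, hx⟩ := exists_eq_of_contracting hβ0 hβ (G.abs_shapley_sub_le hβ0)
  have hne : ∀ v, Nonempty {e : E // G.src e = v} := fun v =>
    let ⟨e, he⟩ := G.exists_arc v; ⟨⟨e, he⟩⟩
  let F : E → ℝ := fun e => (1 - β) * G.reward e + β * x (G.tgt e)
  have hwhite : ∀ v, G.kind v = PositionKind.white →
      x v = ⨆ e : {e : E // G.src e = v}, F e.1 := fun v hk => by
    rw [← congrFun hx v, shapley, hk]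
  have hblack : ∀ v, G.kind v = PositionKind.black →
      x v = ⨅ e : {e : E // G.src e = v}, F e.1 := fun v hk => by
    rw [← congrFun hx v, shapley, hk]
  have hrandom : ∀ v, G.kind v = PositionKind.random →
      x v = ∑ e with G.src e = v, G.prob e * F e := fun v hk => by
    rw [← congrFun hx v, shapley, hk]
  -- Arcs that attain the extrema in the fixed-point equation form the saddle point.
  choose sW hsW using fun v : {v : V // G.kind v = PositionKind.white} =>
    have := hne v.1
    exists_eq_ciSup_of_finite (f := fun e : {e : E // G.src e = v.1} => F e.1)
  choose sB hsB using fun v : {v : V // G.kind v = PositionKind.black} =>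
    have := hne v.1
    exists_eq_ciInf_of_finite (f := fun e : {e : E // G.src e = v.1} => F e.1)
  refine ⟨(sW, sB), x, ?_, fun tW v => ?_, fun tB v => ?_⟩
  · ext v
    rw [arcMean_discounted]
    cases hk : G.kind v with
    | white => rw [arcMean_white G _ _ _ hk, hwhite v hk]; exact (hsW ⟨v, hk⟩).symm
    | black => rw [arcMean_black G _ _ _ hk, hblack v hk]; exact (hsB ⟨v, hk⟩).symm
    | random => rw [arcMean_random G _ _ _ hk, hrandom v hk]
  · rw [arcMean_discounted]
    cases hk : G.kind v with
    | white =>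
      rw [arcMean_white G _ _ _ hk, hwhite v hk]
      exact le_ciSup (f := fun e : {e : E // G.src e = v} => F e.1) (Set.finite_range _).bddAbove
        (tW ⟨v, hk⟩)
    | black => rw [arcMean_black G _ _ _ hk, hblack v hk]; exact (hsB ⟨v, hk⟩).le
    | random => rw [arcMean_random G _ _ _ hk, hrandom v hk]
  · rw [arcMean_discounted]
    cases hk : G.kind v with
    | white => rw [arcMean_white G _ _ _ hk, hwhite v hk]; exact (hsW ⟨v, hk⟩).ge
    | black =>
      rw [arcMean_black G _ _ _ hk, hblack v hk]
      exact ciInf_le (f := fun e : {e : E // G.src e = v} => F e.1) (Set.finite_range _).bddBelow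
        (tB ⟨v, hk⟩)
    | random => rw [arcMean_random G _ _ _ hk, hrandom v hk]

/-- Every BWR-game has a uniformly optimal situation: a situation that is optimal for a sequence of
discount factors that tends to `1`. -/
theorem exists_isUniformlyOptimal (G : BWRGame V E) :
    ∃ sW sB, G.IsUniformlyOptimal sW sB := by
  classical
  let β : ℕ → ℝ := fun n => n / ((n : ℝ) + 1)
  have hβ : ∀ n, 0 ≤ β n ∧ β n < 1 := fun n =>
    ⟨by positivity, (div_lt_one (by positivity)).2 (lt_add_one _)⟩
  have hβ1 : Tendsto β atTop (𝓝 1) := tendsto_natCast_div_add_atTop (1 : ℝ)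
  choose s x hx hW hB using fun n => G.exists_discounted_saddle (hβ n).1 (hβ n).2
  -- There are finitely many situations, so a single one is a discounted saddle point for infinitely
  -- many `n`.
  obtain ⟨t, ht⟩ := Finite.exists_infinite_fiber s
  obtain ⟨φ, hφ, hs⟩ := extraction_of_frequently_atTop
    (Nat.frequently_atTop_iff_infinite.2 (Set.infinite_coe_iff.1 ht))
  replace hs : ∀ n, s (φ n) = t := hs
  have hβφ : Tendsto (fun n => β (φ n)) atTop (𝓝 1) := hβ1.comp hφ.tendsto_atTop
  have hlim : ∀ tW tB (y : ℕ → V → ℝ), (∀ n, y n = (1 - β (φ n)) • G.localReward tW tB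
      + β (φ n) • (G.transition tW tB *ᵥ y n)) →
      Tendsto y atTop (𝓝 (G.meanPayoff tW tB)) := fun tW tB y hy =>
    tendsto_discounted (G.transition_nonneg tW tB) (G.sum_transition tW tB)
      (fun n => hβ (φ n)) hβφ hy
  have hx' := hlim t.1 t.2 (fun n => x (φ n)) fun n => by
    have := hx (φ n)
    rwa [hs] at this
  refine ⟨t.1, t.2, fun tW tB v => ⟨?_, ?_⟩⟩
  · choose y hy using fun n => exists_discounted (G.transition_nonneg tW t.2)
      (G.sum_transition tW t.2) (hβ (φ n)).1 (hβ (φ n)).2 (G.localReward tW t.2)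
    -- The comparison holds at each discount factor: `x - y` dominates its discounted expectation
    -- under the deviating chain, so it is nonnegative.
    refine le_of_tendsto_of_tendsto' (tendsto_pi_nhds.1 (hlim _ _ y hy) v)
      (tendsto_pi_nhds.1 hx' v) fun n => ?_
    refine sub_nonneg.1 (nonneg_of_discounted_le (z := x (φ n) - y n)
      (G.transition_nonneg tW t.2) (G.sum_transition tW t.2) (hβ (φ n)).1 (hβ (φ n)).2 ?_ v)
    rw [Matrix.mulVec_sub, smul_sub]
    have h2 := hW (φ n) tW
    rw [hs] at h2
    intro u
    have h3 := h2 u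
    have h4 := congrFun (hy n) u
    simp only [Pi.add_apply, Pi.sub_apply] at *
    linarith
  · choose y hy using fun n => exists_discounted (G.transition_nonneg t.1 tB)
      (G.sum_transition t.1 tB) (hβ (φ n)).1 (hβ (φ n)).2 (G.localReward t.1 tB)
    refine le_of_tendsto_of_tendsto' (tendsto_pi_nhds.1 hx' v)
      (tendsto_pi_nhds.1 (hlim _ _ y hy) v) fun n => ?_
    refine sub_nonneg.1 (nonneg_of_discounted_le (z := y n - x (φ n))
      (G.transition_nonneg t.1 tB) (G.sum_transition t.1 tB) (hβ (φ n)).1 (hβ (φ n)).2 ?_ v)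
    rw [Matrix.mulVec_sub, smul_sub]
    have h2 := hB (φ n) tB
    rw [hs] at h2
    intro u
    have h3 := h2 u
    have h4 := congrFun (hy n) u
    simp only [Pi.add_apply, Pi.sub_apply] at *
    linarith

/-- The payoff is harmonic for its own chain; at a White or Black position this says that the chosen
arc preserves it. -/
theorem arcMean_meanPayoff (G : BWRGame V E) (sW : G.WhiteStrategy) (sB : G.BlackStrategy)
    (v : V) :
    G.arcMean sW sB (fun e => G.meanPayoff sW sB (G.tgt e)) v = G.meanPayoff sW sB v := by
  rw [← transition_mulVec, meanPayoff_eq_mulVec,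
    mulVec_limitMatrix_mulVec (G.transition_nonneg sW sB) (G.sum_transition sW sB)]

/-- The rows of two situations agree at every position where the situations agree. -/
theorem arcProb_congr (G : BWRGame V E) {sW tW : G.WhiteStrategy} {sB tB : G.BlackStrategy}
    {v : V} (hW : ∀ h, sW ⟨v, h⟩ = tW ⟨v, h⟩) (hB : ∀ h, sB ⟨v, h⟩ = tB ⟨v, h⟩) {e : E}
    (he : G.src e = v) : G.arcProb sW sB e = G.arcProb tW tB e := by
  classical
  subst he
  cases hk : G.kind (G.src e) with
  | white => rw [arcProb_white G _ _ hk, arcProb_white G _ _ hk, hW hk]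
  | black => rw [arcProb_black G _ _ hk, arcProb_black G _ _ hk, hB hk]
  | random => rw [arcProb_random G _ _ hk, arcProb_random G _ _ hk]

theorem transition_congr (G : BWRGame V E) {sW tW : G.WhiteStrategy} {sB tB : G.BlackStrategy}
    {v : V} (hW : ∀ h, sW ⟨v, h⟩ = tW ⟨v, h⟩) (hB : ∀ h, sB ⟨v, h⟩ = tB ⟨v, h⟩) :
    G.transition sW sB v = G.transition tW tB v := by
  classical
  ext u
  exact Finset.sum_congr rfl fun e he => G.arcProb_congr hW hB (Finset.mem_filter.1 he).2.1

theorem localReward_congr (G : BWRGame V E) {sW tW : G.WhiteStrategy} {sB tB : G.BlackStrategy}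
    {v : V} (hW : ∀ h, sW ⟨v, h⟩ = tW ⟨v, h⟩) (hB : ∀ h, sB ⟨v, h⟩ = tB ⟨v, h⟩) :
    G.localReward sW sB v = G.localReward tW tB v := by
  classical
  exact Finset.sum_congr rfl fun e he => by rw [G.arcProb_congr hW hB (Finset.mem_filter.1 he).2]

section Optimal

variable {G : BWRGame V E} {sW : G.WhiteStrategy} {sB : G.BlackStrategy}

/-- No arc of a White position leads to a higher payoff. -/
theorem IsUniformlyOptimal.tgt_le (h : G.IsUniformlyOptimal sW sB) {e : E}
    (hk : G.kind (G.src e) = PositionKind.white) :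
    G.meanPayoff sW sB (G.tgt e) ≤ G.meanPayoff sW sB (G.src e) := by
  classical
  let tW : G.WhiteStrategy := Function.update sW ⟨G.src e, hk⟩ ⟨e, rfl⟩
  have htW : ∀ u, u ≠ G.src e → ∀ h, tW ⟨u, h⟩ = sW ⟨u, h⟩ := fun u hu h =>
    Function.update_of_ne (fun h' => hu (congrArg Subtype.val h')) _ _
  have := mulVec_le_of_deviation (v := G.src e) (ρ' := G.localReward tW sB)
    (ρ := G.localReward sW sB) (G.transition_nonneg sW sB) (G.sum_transition sW sB)
    (G.transition_nonneg tW sB) (G.sum_transition tW sB)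
    (fun u hu => G.transition_congr (htW u hu) fun _ => rfl)
    (fun u hu => G.localReward_congr (htW u hu) fun _ => rfl) fun v => (h tW sB v).1
  rw [← meanPayoff_eq_mulVec, transition_mulVec, arcMean_white G _ _ _ hk] at this
  simpa [tW] using this

/-- No arc of a Black position leads to a lower payoff. -/
theorem IsUniformlyOptimal.le_tgt (h : G.IsUniformlyOptimal sW sB) {e : E}
    (hk : G.kind (G.src e) = PositionKind.black) :
    G.meanPayoff sW sB (G.src e) ≤ G.meanPayoff sW sB (G.tgt e) := by
  classical
  let tB : G.BlackStrategy := Function.update sB ⟨G.src e, hk⟩ ⟨e, rfl⟩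
  have htB : ∀ u, u ≠ G.src e → ∀ h, tB ⟨u, h⟩ = sB ⟨u, h⟩ := fun u hu h =>
    Function.update_of_ne (fun h' => hu (congrArg Subtype.val h')) _ _
  -- Negated rewards turn the minimizer into a maximizer.
  have := mulVec_le_of_deviation (v := G.src e) (ρ' := -G.localReward sW tB)
    (ρ := -G.localReward sW sB) (G.transition_nonneg sW sB) (G.sum_transition sW sB)
    (G.transition_nonneg sW tB) (G.sum_transition sW tB)
    (fun u hu => G.transition_congr (fun _ => rfl) (htB u hu))
    (fun u hu => congrArg Neg.neg (G.localReward_congr (fun _ => rfl) (htB u hu))) (by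
      rw [Matrix.mulVec_neg, Matrix.mulVec_neg, neg_le_neg_iff]
      exact fun v => (h sW tB v).2)
  rw [Matrix.mulVec_neg, ← meanPayoff_eq_mulVec, Matrix.mulVec_neg, Pi.neg_apply, Pi.neg_apply,
    neg_le_neg_iff, transition_mulVec, arcMean_black G _ _ _ hk] at this
  simpa [tB] using this

end Optimal

end

/-! ### Comparing plays of `G[Y](x)` with plays of `G`. -/

section

variable {V E : Type*} [Fintype V] [Fintype E] {G : BWRGame V E} {Y : Finset V} {x : ℝ}
  {hY : G.Restrictable Y}

/-- At the position `v`, the strategy `s` of `G[Y](x)` chooses the same arc as the strategy `t`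
of `G`. -/
def Follows {c : PositionKind} (s : (G.param Y x hY).Strategy c) (t : G.Strategy c) (v : V) :
    Prop :=
  ∀ (hv : v ∈ Y) (hk : G.kind v = c), ∃ h, (s ⟨some ⟨v, hv⟩, hk⟩).1 = Sum.inl ⟨(t ⟨v, hk⟩).1, h⟩

theorem exists_eq_inl_of_param_src {e' : G.ParamArc Y} {v : V} {hv : v ∈ Y}
    (he : (G.param Y x hY).src e' = some ⟨v, hv⟩) (hk : G.kind v ≠ PositionKind.random) :
    ∃ e h, e' = Sum.inl ⟨e, h⟩ ∧ G.src e = v := by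
  rcases e' with ⟨e, h⟩ | ⟨u, hu⟩ | _
  · exact ⟨e, h, rfl, congrArg Subtype.val (Option.some_inj.1 he)⟩
  · have h2 : u = ⟨v, hv⟩ := Option.some_inj.1 he
    subst h2
    exact absurd hu.1 hk
  · exact absurd he (by simp [param])

theorem eq_inr_of_param_src {e' : G.ParamArc Y} (he : (G.param Y x hY).src e' = none) :
    e' = Sum.inr (Sum.inr ()) := by
  rcases e' with e | u | _
  · exact absurd he (by simp [param])
  · exact absurd he (by simp [param])
  · rfl

/-- A strategy of `G[Y](x)` is the restriction of a strategy of `G`. -/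
theorem exists_follows_of_param {c : PositionKind} (hc : c ≠ PositionKind.random)
    (s : (G.param Y x hY).Strategy c) : ∃ t : G.Strategy c, ∀ v, Follows s t v := by
  have : ∀ a : {v : V // G.kind v = c}, ∃ e : {e : E // G.src e = a.1},
      ∀ hv : a.1 ∈ Y, ∃ h, (s ⟨some ⟨a.1, hv⟩, a.2⟩).1 = Sum.inl ⟨e.1, h⟩ := fun a => by
    by_cases hv : a.1 ∈ Y
    · obtain ⟨e, h, he, hs⟩ := exists_eq_inl_of_param_src (s ⟨some ⟨a.1, hv⟩, a.2⟩).2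
        (a.2.trans_ne hc)
      exact ⟨⟨e, hs⟩, fun _ => ⟨h, he⟩⟩
    · obtain ⟨e, he⟩ := G.exists_arc a.1
      exact ⟨⟨e, he⟩, fun h => absurd h hv⟩
  choose t ht using this
  exact ⟨t, fun v hv hk => ht ⟨v, hk⟩ hv⟩

/-- A strategy of `G` can be restricted to `G[Y](x)` as far as its arcs stay in `Y`. -/
theorem exists_param_follows {c : PositionKind} (t : G.Strategy c) :
    ∃ s : (G.param Y x hY).Strategy c, ∀ v, (∀ hk, G.tgt (t ⟨v, hk⟩).1 ∈ Y) → Follows s t v := by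
  have : ∀ a : {a : Option Y // (G.param Y x hY).kind a = c},
      ∃ e : {e : G.ParamArc Y // (G.param Y x hY).src e = a.1},
      ∀ v (hv : v ∈ Y) (hk : G.kind v = c), a.1 = some ⟨v, hv⟩ → G.tgt (t ⟨v, hk⟩).1 ∈ Y →
        ∃ h, e.1 = Sum.inl ⟨(t ⟨v, hk⟩).1, h⟩ := by
    rintro ⟨_ | ⟨v, hv⟩, hk⟩
    · obtain ⟨e, he⟩ := (G.param Y x hY).exists_arc none
      exact ⟨⟨e, he⟩, fun v hv hk h => by simp at h⟩
    · have hk' : G.kind v = c := hk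
      by_cases h : G.tgt (t ⟨v, hk'⟩).1 ∈ Y
      · have hs := (t ⟨v, hk'⟩).2
        refine ⟨⟨Sum.inl ⟨(t ⟨v, hk'⟩).1, hs.symm ▸ hv, h⟩, congrArg some (Subtype.ext hs)⟩, ?_⟩
        rintro u hu hku h2 -
        obtain rfl : v = u := congrArg Subtype.val (Option.some_inj.1 h2)
        exact ⟨_, rfl⟩
      · obtain ⟨e, he⟩ := (G.param Y x hY).exists_arc (some ⟨v, hv⟩)
        refine ⟨⟨e, he⟩, fun u hu hku h2 h3 => ?_⟩
        obtain rfl : v = u := congrArg Subtype.val (Option.some_inj.1 h2)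
        exact absurd h3 h
  choose s hs using this
  exact ⟨s, fun v h hv hk => hs ⟨some ⟨v, hv⟩, hk⟩ v hv hk rfl (h hk)⟩

theorem exitProb_pos {e : E} (hk : G.kind (G.src e) = PositionKind.random) (he : G.tgt e ∉ Y) :
    0 < G.exitProb Y (G.src e) := by
  classical
  rw [exitProb, sub_pos, ← G.prob_sum _ hk]
  refine Finset.sum_lt_sum_of_subset (i := e)
    (Finset.monotone_filter_right _ fun e _ he => he.1) (by simp) (by simp [he])
    (G.prob_pos e hk) fun j hj _ => ?_
  exact (G.prob_pos j ((Finset.mem_filter.1 hj).2.symm ▸ hk)).le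

theorem exitProb_eq_zero {v : V} (hk : G.kind v = PositionKind.random)
    (h : ∀ e, G.src e = v → G.tgt e ∈ Y) : G.exitProb Y v = 0 := by
  classical
  rw [exitProb, sub_eq_zero, ← G.prob_sum _ hk]
  refine Finset.sum_congr (Finset.ext fun e => ?_) fun _ _ => rfl
  simpa using h e

section Situation

variable {sW : (G.param Y x hY).WhiteStrategy} {sB : (G.param Y x hY).BlackStrategy}
  {tW : G.WhiteStrategy} {tB : G.BlackStrategy}

/-- All arcs at a random position have positive probability, so `hcl` forces them into `Y`; there is
then no exit arc, and the outgoing arcs in the two games correspond. -/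
theorem param_arcMean {v : V} (hv : v ∈ Y) (hW : Follows sW tW v) (hB : Follows sB tB v)
    (hcl : ∀ e, G.src e = v → 0 < G.arcProb tW tB e → G.tgt e ∈ Y) {F' : G.ParamArc Y → ℝ}
    {F : E → ℝ}
    (hF : ∀ e h, G.src e = v → 0 < G.arcProb tW tB e → F' (Sum.inl ⟨e, h⟩) = F e) :
    (G.param Y x hY).arcMean sW sB F' (some ⟨v, hv⟩) = G.arcMean tW tB F v := by
  classical
  cases hk : G.kind v with
  | white =>
    obtain ⟨h, he⟩ := hW hv hk
    rw [arcMean_white (G.param Y x hY) sW sB F' (v := some ⟨v, hv⟩) hk, he,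
      arcMean_white G _ _ _ hk]
    exact hF _ h (tW ⟨v, hk⟩).2 (by rw [arcProb_white_self]; exact one_pos)
  | black =>
    obtain ⟨h, he⟩ := hB hv hk
    rw [arcMean_black (G.param Y x hY) sW sB F' (v := some ⟨v, hv⟩) hk, he,
      arcMean_black G _ _ _ hk]
    exact hF _ h (tB ⟨v, hk⟩).2 (by rw [arcProb_black_self]; exact one_pos)
  | random =>
    have hpos : ∀ e, G.src e = v → 0 < G.arcProb tW tB e := by
      rintro e rfl
      rw [arcProb_random G _ _ hk]
      exact G.prob_pos e hk
    have hin : ∀ e, G.src e = v → G.tgt e ∈ Y := fun e he => hcl e he (hpos e he)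
    rw [arcMean_random (G.param Y x hY) sW sB F' (v := some ⟨v, hv⟩) hk, arcMean_random G _ _ _ hk]
    symm
    refine Finset.sum_bij (fun e he => Sum.inl ⟨e, ?_, ?_⟩) ?_ ?_ ?_ ?_
    · rw [(Finset.mem_filter.1 he).2]
      exact hv
    · exact hin e (Finset.mem_filter.1 he).2
    · intro e he
      exact Finset.mem_filter.2
        ⟨Finset.mem_univ _, congrArg some (Subtype.ext (Finset.mem_filter.1 he).2)⟩
    · intro e _ e' _ h
      exact congrArg Subtype.val (Sum.inl_injective h)
    · intro e' he'
      replace he' := (Finset.mem_filter.1 he').2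
      rcases e' with ⟨e, h⟩ | ⟨u, hu⟩ | _
      · exact ⟨e, Finset.mem_filter.2 ⟨Finset.mem_univ _,
          congrArg Subtype.val (Option.some_inj.1 he')⟩, rfl⟩
      · have h2 : u = ⟨v, hv⟩ := Option.some_inj.1 he'
        subst h2
        exact absurd hu.2 (exitProb_eq_zero hk hin).not_gt
      · exact absurd he' (by simp [param])
    · intro e he
      have he' := (Finset.mem_filter.1 he).2
      rw [hF e _ he' (hpos e he')]
      rfl

/-- The payoffs in `G[Y](x)` and in `G` agree on a set of positions that the play never leaves. -/
theorem param_meanPayoff_eq {A : Set V} (hAY : ∀ v ∈ A, v ∈ Y)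
    (hW : ∀ v ∈ A, Follows sW tW v) (hB : ∀ v ∈ A, Follows sB tB v)
    (hcl : ∀ e, G.src e ∈ A → 0 < G.arcProb tW tB e → G.tgt e ∈ A) {v : V} (hv : v ∈ A)
    (hvY : v ∈ Y) :
    (G.param Y x hY).meanPayoff sW sB (some ⟨v, hvY⟩) = G.meanPayoff tW tB v := by
  refine limitMatrix_mulVec_eq_of_rel (G.transition_nonneg tW tB) (G.sum_transition tW tB)
    (transition_nonneg _ sW sB) (sum_transition _ sW sB)
    (fun a' a => a ∈ A ∧ ∃ h : a ∈ Y, a' = some ⟨a, h⟩) ?_ ?_ ⟨hv, hvY, rfl⟩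
  · rintro y' y hy _ a ⟨ha, haY, rfl⟩
    rw [transition_mulVec, transition_mulVec]
    refine param_arcMean haY (hW a ha) (hB a ha) (fun e he hp => ?_) fun e h he hp => ?_
    · exact hAY _ (hcl e (he.symm ▸ ha) hp)
    · exact hy _ _ ⟨hcl e (he.symm ▸ ha) hp, h.2, rfl⟩
  · rintro _ a ⟨ha, haY, rfl⟩
    exact param_arcMean haY (hW a ha) (hB a ha)
      (fun e he hp => hAY _ (hcl e (he.symm ▸ ha) hp)) fun e h he hp => rfl

theorem param_transition_mulVec_none (y : Option Y → ℝ) :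
    ((G.param Y x hY).transition sW sB *ᵥ y) none = y none := by
  rw [transition_mulVec, arcMean_white (G.param Y x hY) sW sB _ (v := none) rfl,
    eq_inr_of_param_src (sW ⟨none, rfl⟩).2]
  rfl

theorem param_meanPayoff_none : (G.param Y x hY).meanPayoff sW sB none = x := by
  rw [meanPayoff_eq_mulVec, limitMatrix_mulVec_of_absorbing (transition_nonneg _ sW sB)
    (sum_transition _ sW sB) fun y => param_transition_mulVec_none y, localReward_eq_arcMean,
    arcMean_white (G.param Y x hY) sW sB _ (v := none) rfl,
    eq_inr_of_param_src (sW ⟨none, rfl⟩).2]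
  rfl

/-- The new position is not reached from the other recurrent positions. -/
theorem param_transition_none {a : Y}
    (ha : Recurrent ((G.param Y x hY).transition sW sB) (some a)) :
    ¬ 0 < (G.param Y x hY).transition sW sB (some a) none := by
  classical
  intro hpos
  -- The indicator of the absorbing position is subharmonic, so a recurrent state cannot move from
  -- its zero set to that position.
  have hsub : (Pi.single none 1 : Option Y → ℝ)
      ≤ (G.param Y x hY).transition sW sB *ᵥ Pi.single none 1 := fun o => by
    cases o with
    | none => rw [param_transition_mulVec_none]
    | some b =>
      rw [Pi.single_eq_of_ne (by simp), Matrix.mulVec_single_one]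
      exact transition_nonneg _ sW sB _ _
  have h := ha.eq_of_step (transition_nonneg _ sW sB) (sum_transition _ sW sB) hsub hpos
  simp at h

/-- The recurrent positions other than `none` are closed under the play in `G`: chosen arcs stay in
`Y` because the strategies follow each other, and a random arc out of `Y` would create a move to
`none`. -/
theorem param_meanPayoff_eq_of_recurrent (hW : ∀ v, Follows sW tW v) (hB : ∀ v, Follows sB tB v)
    {a : Y} (ha : Recurrent ((G.param Y x hY).transition sW sB) (some a)) :
    (G.param Y x hY).meanPayoff sW sB (some a) = G.meanPayoff tW tB a.1 := by
  classical
  refine param_meanPayoff_eq (A := {v | ∃ hv : v ∈ Y,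
    Recurrent ((G.param Y x hY).transition sW sB) (some ⟨v, hv⟩)}) (fun v hv => hv.1)
    (fun v _ => hW v) (fun v _ => hB v) ?_ ⟨a.2, ha⟩ a.2
  rintro e ⟨hv, hrec⟩ hpos
  have hstep : ∀ h : G.src e ∈ Y ∧ G.tgt e ∈ Y,
      0 < (G.param Y x hY).arcProb sW sB (Sum.inl ⟨e, h⟩) → G.tgt e ∈ {v | ∃ hv : v ∈ Y,
        Recurrent ((G.param Y x hY).transition sW sB) (some ⟨v, hv⟩)} := fun h hp =>
    ⟨h.2, hrec.step (transition_nonneg _ sW sB) (sum_transition _ sW sB)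
      (transition_pos _ sW sB hp)⟩
  cases hk : G.kind (G.src e) with
  | white =>
    obtain ⟨h, he⟩ := hW _ hv hk
    have h2 : (tW ⟨G.src e, hk⟩).1 = e := by
      by_contra hne
      rw [arcProb_white G _ _ hk, if_neg hne] at hpos
      exact hpos.false
    simp only [h2] at h he
    refine hstep h ?_
    rw [← he, arcProb_white_self]
    exact one_pos
  | black =>
    obtain ⟨h, he⟩ := hB _ hv hk
    have h2 : (tB ⟨G.src e, hk⟩).1 = e := by
      by_contra hne
      rw [arcProb_black G _ _ hk, if_neg hne] at hpos
      exact hpos.false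
    simp only [h2] at h he
    refine hstep h ?_
    rw [← he, arcProb_black_self]
    exact one_pos
  | random =>
    by_cases ht : G.tgt e ∈ Y
    · refine hstep ⟨hv, ht⟩ ?_
      rw [arcProb_random (G.param Y x hY) sW sB (e := Sum.inl ⟨e, hv, ht⟩) hk]
      exact G.prob_pos e hk
    · have hex := exitProb_pos hk ht
      refine absurd ?_ (param_transition_none hrec)
      refine transition_pos (G.param Y x hY) sW sB
        (e := Sum.inr (Sum.inl ⟨⟨G.src e, hv⟩, hk, hex⟩)) ?_
      rw [arcProb_random (G.param Y x hY) sW sB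
        (e := Sum.inr (Sum.inl ⟨⟨G.src e, hv⟩, hk, hex⟩)) hk]
      exact hex

/-- The bound is checked at recurrent positions only: the loop pays exactly `x`, and the others pay
what they pay in `G`. -/
theorem le_param_meanPayoff (hW : ∀ v, Follows sW tW v) (hB : ∀ v, Follows sB tB v)
    (h : ∀ v ∈ Y, x ≤ G.meanPayoff tW tB v) (o : Option Y) :
    x ≤ (G.param Y x hY).meanPayoff sW sB o := by
  have := limitMatrix_mulVec_le_of_recurrent (transition_nonneg _ sW sB) (sum_transition _ sW sB)
    (f := fun _ => x) (x := (G.param Y x hY).localReward sW sB) fun w hw => by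
      cases w with
      | none => exact param_meanPayoff_none.ge
      | some a => exact (h a.1 a.2).trans (param_meanPayoff_eq_of_recurrent hW hB hw).ge
  rw [limitMatrix_transition_const] at this
  exact this o

theorem param_meanPayoff_le (hW : ∀ v, Follows sW tW v) (hB : ∀ v, Follows sB tB v)
    (h : ∀ v ∈ Y, G.meanPayoff tW tB v ≤ x) (o : Option Y) :
    (G.param Y x hY).meanPayoff sW sB o ≤ x := by
  have := limitMatrix_mulVec_le_of_recurrent (transition_nonneg _ sW sB) (sum_transition _ sW sB)
    (x := fun _ => x) (f := (G.param Y x hY).meanPayoff sW sB) fun w hw => by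
      rw [limitMatrix_transition_const]
      cases w with
      | none => exact param_meanPayoff_none.le
      | some a => exact (param_meanPayoff_eq_of_recurrent hW hB hw).le.trans (h a.1 a.2)
  rw [limitMatrix_transition_const, meanPayoff_eq_mulVec,
    limitMatrix_mulVec_idem (transition_nonneg _ sW sB) (sum_transition _ sW sB)] at this
  exact this o

end Situation

/-! ### The value along arcs and the games on its level sets. -/

theorem mem_ergodicClass {θ : ℝ} {v : V} : v ∈ G.ergodicClass θ ↔ G.value v = θ := by
  classical
  simp [ergodicClass]

section Value

variable {tW : G.WhiteStrategy} {tB : G.BlackStrategy}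

theorem IsUniformlyOptimal.value_tgt_white (h : G.IsUniformlyOptimal tW tB) {v : V}
    (hk : G.kind v = PositionKind.white) : G.value (G.tgt (tW ⟨v, hk⟩).1) = G.value v := by
  rw [G.value_eq_meanPayoff h, G.value_eq_meanPayoff h, ← G.arcMean_meanPayoff tW tB v,
    arcMean_white G _ _ _ hk]

theorem IsUniformlyOptimal.value_tgt_black (h : G.IsUniformlyOptimal tW tB) {v : V}
    (hk : G.kind v = PositionKind.black) : G.value (G.tgt (tB ⟨v, hk⟩).1) = G.value v := by
  rw [G.value_eq_meanPayoff h, G.value_eq_meanPayoff h, ← G.arcMean_meanPayoff tW tB v,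
    arcMean_black G _ _ _ hk]

theorem value_tgt_le {e : E} (hk : G.kind (G.src e) = PositionKind.white) :
    G.value (G.tgt e) ≤ G.value (G.src e) := by
  obtain ⟨tW, tB, h⟩ := G.exists_isUniformlyOptimal
  rw [G.value_eq_meanPayoff h, G.value_eq_meanPayoff h]
  exact h.tgt_le hk

theorem value_le_tgt {e : E} (hk : G.kind (G.src e) = PositionKind.black) :
    G.value (G.src e) ≤ G.value (G.tgt e) := by
  obtain ⟨tW, tB, h⟩ := G.exists_isUniformlyOptimal
  rw [G.value_eq_meanPayoff h, G.value_eq_meanPayoff h]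
  exact h.le_tgt hk

/-- Rows at random positions do not depend on the situation, so harmonicity transfers from an
optimal situation to any other. -/
theorem arcMean_value_random (sW : G.WhiteStrategy) (sB : G.BlackStrategy) {v : V}
    (hk : G.kind v = PositionKind.random) :
    G.arcMean sW sB (fun e => G.value (G.tgt e)) v = G.value v := by
  classical
  obtain ⟨tW, tB, h⟩ := G.exists_isUniformlyOptimal
  simp only [G.value_eq_meanPayoff h]
  rw [← G.arcMean_meanPayoff tW tB v, arcMean_random G _ _ _ hk, arcMean_random G _ _ _ hk]

end Value

/-- The arc chosen by an optimal situation of `G` preserves the value, hence stays in the class. -/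
theorem restrictable_ergodicClass (G : BWRGame V E) (θ : ℝ) :
    G.Restrictable (G.ergodicClass θ) := by
  obtain ⟨tW, tB, h⟩ := G.exists_isUniformlyOptimal
  intro v hv hk
  rw [mem_ergodicClass] at hv
  cases hk' : G.kind v with
  | white =>
    exact ⟨_, (tW ⟨v, hk'⟩).2, mem_ergodicClass.2 ((h.value_tgt_white hk').trans hv)⟩
  | black =>
    exact ⟨_, (tB ⟨v, hk'⟩).2, mem_ergodicClass.2 ((h.value_tgt_black hk').trans hv)⟩
  | random => exact absurd hk' hk

section ErgodicClass

variable {θ : ℝ} {hwd : G.Restrictable (G.ergodicClass θ)}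
  {sW : (G.param (G.ergodicClass θ) θ hwd).WhiteStrategy}
  {sB : (G.param (G.ergodicClass θ) θ hwd).BlackStrategy}

/-- The game `G[θ]` has value `θ` at every position. -/
theorem IsUniformlyOptimal.param_ergodicClass
    (h : (G.param (G.ergodicClass θ) θ hwd).IsUniformlyOptimal sW sB)
    (o : Option (G.ergodicClass θ)) :
    (G.param (G.ergodicClass θ) θ hwd).meanPayoff sW sB o = θ := by
  obtain ⟨tW, tB, ht⟩ := G.exists_isUniformlyOptimal
  have hstay : ∀ v, v ∈ G.ergodicClass θ →
      (∀ hk, G.tgt (tW ⟨v, hk⟩).1 ∈ G.ergodicClass θ) ∧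
      ∀ hk, G.tgt (tB ⟨v, hk⟩).1 ∈ G.ergodicClass θ := fun v hv => by
    simp only [mem_ergodicClass] at *
    exact ⟨fun hk => (ht.value_tgt_white hk).trans hv, fun hk => (ht.value_tgt_black hk).trans hv⟩
  have hval : ∀ v ∈ G.ergodicClass θ, G.meanPayoff tW tB v = θ := fun v hv => by
    rw [← G.value_eq_meanPayoff ht, mem_ergodicClass.1 hv]
  apply le_antisymm
  -- Black answers with the restriction of the globally optimal `tB`. Lifting `sW` to `uW` brings in
  -- the optimality of `tB` in `G`, which caps White at `θ` on the class.
  · obtain ⟨uW, huW⟩ := exists_follows_of_param (by simp) sW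
    obtain ⟨tB', htB'⟩ := exists_param_follows (x := θ) (hY := hwd) tB
    exact (h sW tB' o).2.trans (param_meanPayoff_le huW
      (fun v hv => htB' v (hstay v hv).2 hv) (fun v hv => (ht uW tB v).1.trans (hval v hv).le) o)
  · obtain ⟨uB, huB⟩ := exists_follows_of_param (by simp) sB
    obtain ⟨tW', htW'⟩ := exists_param_follows (x := θ) (hY := hwd) tW
    exact (le_param_meanPayoff (fun v hv => htW' v (hstay v hv).1 hv) huB
      (fun v hv => (hval v hv).ge.trans (ht tW uB v).2) o).trans (h tW' sB o).1

end ErgodicClass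

/-! ### Concatenating optimal situations of the classes. -/

section Concatenation

variable {ι : Type*} {θ : ι → ℝ} {hwd : ∀ i, G.Restrictable (G.ergodicClass (θ i))}
  {sW : ∀ i, (G.param (G.ergodicClass (θ i)) (θ i) (hwd i)).WhiteStrategy}
  {sB : ∀ i, (G.param (G.ergodicClass (θ i)) (θ i) (hwd i)).BlackStrategy}
  {tW : G.WhiteStrategy} {tB : G.BlackStrategy}

theorem Follows.tgt_mem {c : PositionKind} {s : (G.param Y x hY).Strategy c} {t : G.Strategy c}
    {v : V} (h : Follows s t v) (hv : v ∈ Y) (hk : G.kind v = c) : G.tgt (t ⟨v, hk⟩).1 ∈ Y :=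
  (h hv hk).1.2

/-- The concatenated White strategy guarantees the value. -/
theorem value_le_meanPayoff (hcover : ∀ v, ∃ i, v ∈ G.ergodicClass (θ i))
    (hopt : ∀ i, (G.param (G.ergodicClass (θ i)) (θ i) (hwd i)).IsUniformlyOptimal (sW i) (sB i))
    (hW : ∀ i v, Follows (sW i) tW v) (uB : G.BlackStrategy) :
    G.value ≤ G.meanPayoff tW uB := by
  have h0 := G.transition_nonneg tW uB
  have h1 := G.sum_transition tW uB
  -- Whatever Black does, the expected value does not drop: White's arcs stay in the class, Black's
  -- arcs cannot lower the value, and random moves average it.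
  have hsub : G.value ≤ G.transition tW uB *ᵥ G.value := fun v => by
    rw [transition_mulVec]
    cases hk : G.kind v with
    | white =>
      obtain ⟨i, hi⟩ := hcover v
      rw [arcMean_white G _ _ _ hk, mem_ergodicClass.1 ((hW i v).tgt_mem hi hk),
        mem_ergodicClass.1 hi]
    | black =>
      rw [arcMean_black G _ _ _ hk]
      have h2 : G.src (uB ⟨v, hk⟩).1 = v := (uB ⟨v, hk⟩).2
      have h3 := value_le_tgt (e := (uB ⟨v, hk⟩).1) (h2.symm ▸ hk)
      rwa [h2] at h3
    | random => exact (arcMean_value_random tW uB hk).ge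
  refine (le_limitMatrix_mulVec h0 h1 hsub).trans
    (limitMatrix_mulVec_le_of_recurrent h0 h1 fun w hw => ?_)
  obtain ⟨i, hi⟩ := hcover w
  -- The subharmonic value is constant along recurrent moves, so recurrent play never leaves its
  -- class.
  have hcl : ∀ e, G.src e ∈ {v | v ∈ G.ergodicClass (θ i) ∧ Recurrent (G.transition tW uB) v} →
      0 < G.arcProb tW uB e →
      G.tgt e ∈ {v | v ∈ G.ergodicClass (θ i) ∧ Recurrent (G.transition tW uB) v} := by
    rintro e ⟨hv, hrec⟩ hp
    have hp' := transition_pos G tW uB hp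
    refine ⟨?_, hrec.step h0 h1 hp'⟩
    rw [mem_ergodicClass, hrec.eq_of_step h0 h1 hsub hp', mem_ergodicClass.1 hv]
  -- `uB` may leave the class at transient positions; agreement of `uB'` with `uB` is needed only on
  -- the closed recurrent set.
  obtain ⟨uB', huB'⟩ := exists_param_follows (x := θ i) (hY := hwd i) uB
  rw [← meanPayoff_eq_mulVec, ← param_meanPayoff_eq (fun v hv => hv.1) (fun v _ => hW i v)
    (fun v hv => huB' v fun hk => (hcl (uB ⟨v, hk⟩).1 ((uB ⟨v, hk⟩).2.symm ▸ hv) (by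
      rw [arcProb_black_self]; exact one_pos)).1) hcl ⟨hi, hw⟩ hi, mem_ergodicClass.1 hi]
  exact ((hopt i).param_ergodicClass (some ⟨w, hi⟩)).ge.trans (hopt i (sW i) uB' _).2

/-- The concatenated Black strategy guarantees the value. -/
theorem meanPayoff_le_value (hcover : ∀ v, ∃ i, v ∈ G.ergodicClass (θ i))
    (hopt : ∀ i, (G.param (G.ergodicClass (θ i)) (θ i) (hwd i)).IsUniformlyOptimal (sW i) (sB i))
    (hB : ∀ i v, Follows (sB i) tB v) (uW : G.WhiteStrategy) :
    G.meanPayoff uW tB ≤ G.value := by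
  have h0 := G.transition_nonneg uW tB
  have h1 := G.sum_transition uW tB
  have hsup : G.transition uW tB *ᵥ G.value ≤ G.value := fun v => by
    rw [transition_mulVec]
    cases hk : G.kind v with
    | white =>
      rw [arcMean_white G _ _ _ hk]
      have h2 : G.src (uW ⟨v, hk⟩).1 = v := (uW ⟨v, hk⟩).2
      have h3 := value_tgt_le (e := (uW ⟨v, hk⟩).1) (h2.symm ▸ hk)
      rwa [h2] at h3
    | black =>
      obtain ⟨i, hi⟩ := hcover v
      rw [arcMean_black G _ _ _ hk, mem_ergodicClass.1 ((hB i v).tgt_mem hi hk),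
        mem_ergodicClass.1 hi]
    | random => exact (arcMean_value_random uW tB hk).le
  -- Here the value is superharmonic; negation makes the results on subharmonic functions
  -- applicable.
  have hsub : -G.value ≤ G.transition uW tB *ᵥ -G.value := by
    rw [Matrix.mulVec_neg]
    exact neg_le_neg hsup
  have hlim : limitMatrix (G.transition uW tB) *ᵥ G.value ≤ G.value := by
    have := le_limitMatrix_mulVec h0 h1 hsub
    rwa [Matrix.mulVec_neg, neg_le_neg_iff] at this
  have hrecur : ∀ w, Recurrent (G.transition uW tB) w → G.meanPayoff uW tB w ≤ G.value w := by
    intro w hw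
    obtain ⟨i, hi⟩ := hcover w
    have hcl : ∀ e, G.src e ∈ {v | v ∈ G.ergodicClass (θ i) ∧ Recurrent (G.transition uW tB) v} →
        0 < G.arcProb uW tB e →
        G.tgt e ∈ {v | v ∈ G.ergodicClass (θ i) ∧ Recurrent (G.transition uW tB) v} := by
      rintro e ⟨hv, hrec⟩ hp
      have hp' := transition_pos G uW tB hp
      refine ⟨?_, hrec.step h0 h1 hp'⟩
      rw [mem_ergodicClass, ← neg_inj.1 (hrec.eq_of_step h0 h1 hsub hp').symm,
        mem_ergodicClass.1 hv]
    obtain ⟨uW', huW'⟩ := exists_param_follows (x := θ i) (hY := hwd i) uW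
    rw [← param_meanPayoff_eq (fun v hv => hv.1)
      (fun v hv => huW' v fun hk => (hcl (uW ⟨v, hk⟩).1 ((uW ⟨v, hk⟩).2.symm ▸ hv) (by
        rw [arcProb_white_self]; exact one_pos)).1) (fun v _ => hB i v) hcl ⟨hi, hw⟩ hi,
      mem_ergodicClass.1 hi]
    exact (hopt i uW' (sB i) _).1.trans ((hopt i).param_ergodicClass (some ⟨w, hi⟩)).le
  refine le_trans ?_ hlim
  have h2 := limitMatrix_mulVec_le_of_recurrent h0 h1 (f := -G.value)
    (x := -G.localReward uW tB) fun w hw => by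
      rw [Matrix.mulVec_neg]
      exact neg_le_neg (hrecur w hw)
  rwa [Matrix.mulVec_neg, Matrix.mulVec_neg, neg_le_neg_iff] at h2

/-- Strategies of the games on the classes of a partition can be concatenated. -/
theorem exists_follows_concatenation {ι : Type*} {Y : ι → Finset V} {x : ι → ℝ}
    {hY : ∀ i, G.Restrictable (Y i)} (hdisj : ∀ i j v, v ∈ Y i → v ∈ Y j → i = j)
    (hcover : ∀ v, ∃ i, v ∈ Y i) {c : PositionKind} (hc : c ≠ PositionKind.random)
    (s : ∀ i, (G.param (Y i) (x i) (hY i)).Strategy c) :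
    ∃ t : G.Strategy c, ∀ i v, Follows (s i) t v := by
  choose i hi using hcover
  choose t ht using fun j => exists_follows_of_param hc (s j)
  refine ⟨fun a => t (i a.1) a, fun j v hv hk => ?_⟩
  obtain rfl := hdisj _ _ v hv (hi v)
  exact ht _ v hv hk

end Concatenation

end

end BWRGame

theorem mainTheorem5 {V E : Type*} [Fintype V] [Fintype E] (G : BWRGame V E)
    (ℓ : ℕ) (θ : Fin ℓ → ℝ) (hθ : StrictMono θ)
    (hne : ∀ i, (G.ergodicClass (θ i)).Nonempty)
    (hcover : ∀ v, ∃ i, v ∈ G.ergodicClass (θ i)) :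
    ∃ hwd : ∀ i, G.Restrictable (G.ergodicClass (θ i)),
      ∀ (sW : ∀ i, (G.param (G.ergodicClass (θ i)) (θ i) (hwd i)).WhiteStrategy)
        (sB : ∀ i, (G.param (G.ergodicClass (θ i)) (θ i) (hwd i)).BlackStrategy),
        (∀ i, (G.param (G.ergodicClass (θ i)) (θ i) (hwd i)).IsUniformlyOptimal (sW i) (sB i)) →
        (∃ tW tB, G.IsConcatenation (fun i => G.ergodicClass (θ i)) θ hwd sW sB tW tB) ∧
        ∀ (tW : G.WhiteStrategy) (tB : G.BlackStrategy),
          G.IsConcatenation (fun i => G.ergodicClass (θ i)) θ hwd sW sB tW tB →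
          G.IsUniformlyOptimal tW tB := by
  have hdisj : ∀ i j v, v ∈ G.ergodicClass (θ i) → v ∈ G.ergodicClass (θ j) → i = j :=
    fun i j v hi hj => hθ.injective
      ((BWRGame.mem_ergodicClass.1 hi).symm.trans (BWRGame.mem_ergodicClass.1 hj))
  refine ⟨fun i => G.restrictable_ergodicClass (θ i), fun sW sB hopt => ⟨?_, ?_⟩⟩
  · obtain ⟨tW, hW⟩ := BWRGame.exists_follows_concatenation hdisj hcover (by simp) sW
    obtain ⟨tB, hB⟩ := BWRGame.exists_follows_concatenation hdisj hcover (by simp) sB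
    exact ⟨tW, tB, hW, hB⟩
  · rintro tW tB ⟨hW, hB⟩ uW uB v
    have hle := BWRGame.value_le_meanPayoff hcover hopt hW
    have hge := BWRGame.meanPayoff_le_value hcover hopt hB
    -- The value separates the payoffs: White's deviations stay below it, Black's stay above it, and
    -- the pair `(tW, tB)` satisfies both bounds.
    exact ⟨(hge uW v).trans (hle tB v), (hge tW v).trans (hle uB v)⟩
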